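/- Let $\Omega\subset\mathbb{R}^2$ be a bounded Lipschitz domain with boundary $\Gamma=\partial\Omega$ and exterior unit normal $n$. Let $S\subset\Omega$ be a boundary layer, i.e. a Lipschitz domain with $\Gamma\subset\partial S$ together with a (finite) conforming triangulation $\mathcal{T}$ of $\overline S$ into non-degenerate closed triangles, and put $\Gamma^c:=\partial S\setminus\Gamma$. For $p\in\mathbb{N}$, $p\ge 1$, let $$\mathcal{S}^p_{\Gamma^c}(\mathcal{T}):=\{\varphi_h\in C^0(\overline S):\ \varphi_h|_T\text{ is a polynomial of degree at most }p\text{ for all }T\in\mathcal{T},\ \varphi_h=0\text{ on }\Gamma^c\},$$ and for $\varphi_h\in\mathcal{S}^p_{\Gamma^c}(\mathcal{T})$ let $\nabla\varphi_h$ be its piecewise gradient (on $\Gamma$, taken from inside $S$) and $\operatorname{\mathbf{curl}}\varphi_h:=(-\partial_2\varphi_h,\partial_1\varphi_h)$. Let $g\in H^{1/2}(\Gamma)$, i.e. $g$ is the trace of a function in $H^1(\Omega)$, and let $u\in H^1(\Omega)$ be the weak solution of $\Delta u=0$ in $\Omega$ with trace $u|_\Gamma=g$. Let $v\in H^1(\Omega)$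 satisfy $\Delta v=0$ weakly in $\Omega$, with trace $v|_\Gamma$. Consider the discrete problem: find $\widetilde w_h\in\mathcal{S}^p_{\Gamma^c}(\mathcal{T})$ with $$(\nabla\widetilde w_h,\nabla\varphi_h)_{L^2(S)}=(g-v|_\Gamma,\ n\cdot\operatorname{\mathbf{curl}}\varphi_h)_{L^2(\Gamma)}\qquad\text{for all }\varphi_h\in\mathcal{S}^p_{\Gamma^c}(\mathcal{T}).$$ If $\Gamma^c\neq\emptyset$ (equivalently $S\ne\Omega$), this problem has exactly one solution. Moreover, every solution $\widetilde w_h$ (whether or not $\Gamma^c$ is empty) satisfies $$2\,(g-v|_\Gamma,\ n\cdot\operatorname{\mathbf{curl}}\widetilde w_h)_{L^2(\Gamma)}-\|\nabla\widetilde w_h\|_{L^2(S)}^2\ \le\ \|\nabla(u-v)\|_{L^2(\Omega)}^2 .$$ -/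

import Mathlib

open MeasureTheory Filter Topology
open scoped ContDiff RealInnerProductSpace

namespace BoundaryLayer

/-- The Euclidean plane `ℝ²`. -/
abbrev Plane : Type := EuclideanSpace ℝ (Fin 2)

noncomputable section

/-! ### Domains, boundary measure, exterior normal -/

/-- A Lipschitz domain in the plane: a nonempty connected open set which, near each of its boundary
points and in suitable Cartesian coordinates, is the set of points strictly below the graph of a
Lipschitz function. -/
structure IsLipschitzDomain (Ω : Set Plane) : Prop where
  isOpen : IsOpen Ω
  isConnected : IsConnected Ω
  locally_subgraph : ∀ x ∈ frontier Ω, ∃ (e : Plane ≃ᵃⁱ[ℝ] Plane) (K : NNReal) (f : ℝ → ℝ),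
    LipschitzWith K f ∧ ∃ r > 0, ∀ y ∈ Metric.ball x r, (y ∈ Ω ↔ (e y) 1 < f ((e y) 0))

/-- Arc length on the boundary `∂Ω`. -/
def boundaryMeasure (Ω : Set Plane) : Measure Plane :=
  (Measure.hausdorffMeasure 1 : Measure Plane).restrict (frontier Ω)

/-- `n` is the exterior unit normal of `Ω` at `x`: a unit vector such that, infinitesimally at `x`,
the set `Ω` is the half plane `{y | ⟪n, y - x⟫ < 0}`. -/
def IsExteriorNormalAt (Ω : Set Plane) (x n : Plane) : Prop :=
  ‖n‖ = 1 ∧ ∀ ε > 0, ∀ᶠ y in 𝓝 x,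
    (⟪n, y - x⟫ < -(ε * ‖y - x‖) → y ∈ Ω) ∧ (ε * ‖y - x‖ < ⟪n, y - x⟫ → y ∉ closure Ω)

open Classical in
/-- The exterior unit normal field; it is determined at every boundary point where the boundary has
a tangent line, hence almost everywhere on the boundary of a Lipschitz domain (value `0` at the
other points). -/
def exteriorNormal (Ω : Set Plane) (x : Plane) : Plane :=
  if h : ∃ n, IsExteriorNormalAt Ω x n then h.choose else 0

/-! ### The Sobolev space `H¹(Ω)`, traces, harmonic functions -/

/-- `ψ ∈ C_c^∞(Ω)`. -/
def IsTestFunction (Ω : Set Plane) (ψ : Plane → ℝ) : Prop :=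
  ContDiff ℝ ∞ ψ ∧ HasCompactSupport ψ ∧ tsupport ψ ⊆ Ω

/-- `G ∈ L²(Ω)²` is the weak gradient of `φ` in `Ω`. -/
def IsWeakGradient (Ω : Set Plane) (φ : Plane → ℝ) (G : Plane → Plane) : Prop :=
  MemLp G 2 (volume.restrict Ω) ∧
    ∀ ψ, IsTestFunction Ω ψ → ∫ x in Ω, φ x • gradient ψ x = -∫ x in Ω, ψ x • G x

/-- `φ ∈ H¹(Ω)`. -/
def MemH1 (Ω : Set Plane) (φ : Plane → ℝ) : Prop :=
  MemLp φ 2 (volume.restrict Ω) ∧ ∃ G, IsWeakGradient Ω φ G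

open Classical in
/-- The weak gradient of `φ ∈ H¹(Ω)`, unique up to null sets (value `0` if `φ` has none). -/
def weakGradient (Ω : Set Plane) (φ : Plane → ℝ) : Plane → Plane :=
  if h : ∃ G, IsWeakGradient Ω φ G then h.choose else 0

/-- `f ∈ L²(∂Ω)` is the trace of `φ ∈ H¹(Ω)`. The trace operator is the continuous extension to
`H¹(Ω)` of the restriction `Φ ↦ Φ|_{∂Ω}` of functions that are smooth up to the boundary. -/
def HasTrace (Ω : Set Plane) (φ f : Plane → ℝ) : Prop :=
  MemH1 Ω φ ∧ MemLp f 2 (boundaryMeasure Ω) ∧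
    ∃ Φ : ℕ → Plane → ℝ, (∀ k, ContDiff ℝ ∞ (Φ k)) ∧
      Tendsto (fun k => eLpNorm (φ - Φ k) 2 (volume.restrict Ω)) atTop (𝓝 0) ∧
      Tendsto (fun k => eLpNorm (weakGradient Ω φ - gradient (Φ k)) 2 (volume.restrict Ω))
        atTop (𝓝 0) ∧
      Tendsto (fun k => eLpNorm (f - Φ k) 2 (boundaryMeasure Ω)) atTop (𝓝 0)

/-- `φ ∈ H¹(Ω)` with `Δ φ = 0` in `Ω` in the weak sense. -/
def IsHarmonicH1 (Ω : Set Plane) (φ : Plane → ℝ) : Prop :=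
  MemH1 Ω φ ∧ ∀ ψ, IsTestFunction Ω ψ → ∫ x in Ω, ⟪weakGradient Ω φ x, gradient ψ x⟫ = 0

/-- `u ∈ H¹(Ω)` solves `Δ u = 0` in `Ω`, `u = g` on `∂Ω`. -/
def SolvesDirichlet (Ω : Set Plane) (g u : Plane → ℝ) : Prop :=
  IsHarmonicH1 Ω u ∧ HasTrace Ω u g

/-! ### Boundary layers and finite elements -/

/-- A conforming triangulation of the set `A` into finitely many nondegenerate closed triangles,
given by their vertex sets; two triangles meet in the convex hull of their common vertices. -/
structure IsTriangulation (A : Set Plane) (T : Finset (Finset Plane)) : Prop where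
  card_eq : ∀ t ∈ T, t.card = 3
  indep : ∀ t ∈ T, AffineIndependent ℝ ((↑) : t → Plane)
  covers : (⋃ t ∈ T, convexHull ℝ (t : Set Plane)) = A
  conforming : ∀ s ∈ T, ∀ t ∈ T,
    convexHull ℝ (s : Set Plane) ∩ convexHull ℝ (t : Set Plane) =
      convexHull ℝ ((s : Set Plane) ∩ (t : Set Plane))

/-- `S ⊆ Ω` is a boundary layer of `Ω` with conforming triangulation `T`. -/
structure IsBoundaryLayer (Ω S : Set Plane) (T : Finset (Finset Plane)) : Prop where
  subset : S ⊆ Ω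
  lipschitz : IsLipschitzDomain S
  frontier_subset : frontier Ω ⊆ frontier S
  triangulation : IsTriangulation (closure S) T

/-- The interior part `Γᶜ = ∂S \ ∂Ω` of the boundary of a boundary layer `S`. -/
def innerBoundary (Ω S : Set Plane) : Set Plane := frontier S \ frontier Ω

/-- The Lagrange finite element space of degree `p` on `S` with zero values on `Γᶜ`: functions
that are continuous on `closure S`, polynomial of total degree at most `p` on each triangle, and
zero on `Γᶜ`. A function on `closure S` is represented by its extension by zero to the plane. -/
structure MemFEM (p : ℕ) (Ω S : Set Plane) (T : Finset (Finset Plane)) (φ : Plane → ℝ) :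
    Prop where
  continuousOn : ContinuousOn φ (closure S)
  polynomial : ∀ t ∈ T, ∃ P : MvPolynomial (Fin 2) ℝ, P.totalDegree ≤ p ∧
    ∀ x ∈ convexHull ℝ (t : Set Plane), φ x = MvPolynomial.eval (fun i => x i) P
  zero_inner : ∀ x ∈ innerBoundary Ω S, φ x = 0
  zero_outside : ∀ x, x ∉ closure S → φ x = 0

/-- The gradient of a finite element function on `closure S`. It is the classical gradient in the
interior of each triangle, and the one-sided gradient, taken from inside `S`, at all points of
`∂S` other than vertices of the triangulation. -/
def femGradient (S : Set Plane) (φ : Plane → ℝ) (x : Plane) : Plane :=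
  gradientWithin φ (closure S) x

/-- The vectorial curl `(-∂₂ φ, ∂₁ φ)` of a finite element function on `closure S`. -/
def femCurl (S : Set Plane) (φ : Plane → ℝ) (x : Plane) : Plane :=
  !₂[-(femGradient S φ x 1), femGradient S φ x 0]

/-- The scalar product `(f, n · curl φ)` in `L²(∂Ω)`. -/
def boundaryForm (Ω S : Set Plane) (f φ : Plane → ℝ) : ℝ :=
  ∫ x, f x * ⟪exteriorNormal Ω x, femCurl S φ x⟫ ∂(boundaryMeasure Ω)

/-- `w` belongs to the finite element space and
`(∇ w, ∇ φ)_{L²(S)} = (f, n · curl φ)_{L²(∂Ω)}` for all `φ` in the finite element space. -/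
def SolvesDiscrete (p : ℕ) (Ω S : Set Plane) (T : Finset (Finset Plane)) (f w : Plane → ℝ) :
    Prop :=
  MemFEM p Ω S T w ∧ ∀ φ, MemFEM p Ω S T φ →
    ∫ x in S, ⟪femGradient S w x, femGradient S φ x⟫ = boundaryForm Ω S f φ

end

end BoundaryLayer

open BoundaryLayer

/-! The curl is the gradient rotated by a right angle, so `‖curl φ‖ = ‖∇φ‖` pointwise. The theorem
rests on one identity: if `f` is the trace of `w ∈ H¹(Ω)`, then `(f, n · curl φ)` over `Γ` equals
`(∇w, curl φ)` over `S` for every finite element function `φ`.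

For smooth `w` this is Green's formula on each triangle (`IsTriangle.green`), summed over the
triangulation. Only tangential derivatives of `φ` enter the edge terms. On an edge shared by two
triangles they agree by continuity while the normals are opposite, so the terms cancel; on `Γᶜ` they
vanish with `φ`; on `Γ` the edge normal is the exterior normal of `Ω`
(`IsBoundaryLayer.edgeFlux_eq`). Both sides are continuous in the sense in which traces are defined,
which gives `IsBoundaryLayer.green_trace`.

With `G = ∇u - ∇v` the right-hand side of the discrete problem is therefore `(G, curl φ)_S = (-rot
G, ∇φ)_S` (`IsBoundaryLayer.boundaryForm_sub_eq`). A solution is a function whose gradient is the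
`L²(S)` projection of `-rot G` onto the finite-dimensional space of discrete gradients
(`finiteDimensional_femSpace`). It is unique when `Γᶜ` is nonempty, because a finite element
function with zero gradient is then zero (`injective_gradL2`). The bound is `2⟪G, curl w⟫ - ‖curl
w‖² ≤ ‖G‖²`, integrated over `S ⊆ Ω`. -/

namespace BoundaryLayer

noncomputable section

/-! ### Rotation by a right angle -/

/-- Rotation of the plane by `π / 2`. -/
def rot (v : Plane) : Plane := !₂[-(v 1), v 0]

lemma inner_plane (a b : Plane) : ⟪a, b⟫ = a 0 * b 0 + a 1 * b 1 := by
  simp [PiLp.inner_apply, Fin.sum_univ_two, mul_comm]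

@[simp] lemma rot_zero_coord (v : Plane) : rot v 0 = -(v 1) := rfl

@[simp] lemma rot_one_coord (v : Plane) : rot v 1 = v 0 := rfl

lemma plane_ext {a b : Plane} (h0 : a 0 = b 0) (h1 : a 1 = b 1) : a = b := by
  ext i; fin_cases i <;> assumption

lemma inner_rot_right (a b : Plane) : ⟪a, rot b⟫ = -⟪rot a, b⟫ := by
  simp [inner_plane]

lemma rot_rot (a : Plane) : rot (rot a) = -a := by
  apply plane_ext <;> simp

lemma rot_smul (r : ℝ) (a : Plane) : rot (r • a) = r • rot a := by
  apply plane_ext <;> simp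

lemma rot_add (a b : Plane) : rot (a + b) = rot a + rot b := by
  apply plane_ext <;> simp [add_comm]

lemma rot_neg (a : Plane) : rot (-a) = -rot a := by
  apply plane_ext <;> simp

lemma norm_rot (a : Plane) : ‖rot a‖ = ‖a‖ := by
  rw [← sq_eq_sq₀ (norm_nonneg _) (norm_nonneg _), ← real_inner_self_eq_norm_sq,
    ← real_inner_self_eq_norm_sq, inner_plane, inner_plane]
  simp; ring

/-- Rotation by `π / 2` as a linear isometry. -/
def rotₗᵢ : Plane →ₗᵢ[ℝ] Plane where
  toFun := rot
  map_add' := rot_add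
  map_smul' := rot_smul
  norm_map' := norm_rot

lemma continuous_rot : Continuous rot := rotₗᵢ.continuous

/-! ### Barycentric coordinates on triangles -/

/-- The vertex sets of nondegenerate triangles. -/
structure IsTriangle (t : Finset Plane) : Prop where
  card_eq : t.card = 3
  indep : AffineIndependent ℝ ((↑) : t → Plane)

/-- The vertices of a triangle as an affine basis of the plane. -/
def IsTriangle.basis {t : Finset Plane} (h : IsTriangle t) : AffineBasis t ℝ Plane :=
  ⟨(↑), h.indep, by
    rw [h.indep.affineSpan_eq_top_iff_card_eq_finrank_add_one]
    simp [h.card_eq]⟩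

lemma IsTriangle.range_basis {t : Finset Plane} (h : IsTriangle t) :
    Set.range h.basis = (t : Set Plane) := by
  change Set.range ((↑) : t → Plane) = _
  simp

lemma IsTriangle.basis_apply {t : Finset Plane} (h : IsTriangle t) (c : t) :
    h.basis c = c := rfl

open Classical in
/-- The barycentric coordinate of the triangle `t` belonging to the vertex `c`. -/
def bary (t : Finset Plane) (c : Plane) : Plane →ᵃ[ℝ] ℝ :=
  -- The junk value `0` makes `bary` total, so that sums over `c ∈ t` need no membership proofs.
  if h : IsTriangle t ∧ c ∈ t then h.1.basis.coord ⟨c, h.2⟩ else 0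

variable {t : Finset Plane} {c d x : Plane}

lemma IsTriangle.bary_eq (h : IsTriangle t) (hc : c ∈ t) :
    bary t c = h.basis.coord ⟨c, hc⟩ := by
  rw [bary, dif_pos ⟨h, hc⟩]

lemma IsTriangle.bary_self (h : IsTriangle t) (hc : c ∈ t) : bary t c c = 1 := by
  rw [h.bary_eq hc]
  exact h.basis.coord_apply_eq ⟨c, hc⟩

lemma IsTriangle.bary_of_ne (h : IsTriangle t) (hc : c ∈ t) (hd : d ∈ t) (hcd : c ≠ d) :
    bary t c d = 0 := by
  rw [h.bary_eq hc]
  exact h.basis.coord_apply_ne (i := ⟨c, hc⟩) (j := ⟨d, hd⟩) (by simpa using hcd)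

lemma IsTriangle.mem_convexHull_iff (h : IsTriangle t) :
    x ∈ convexHull ℝ (t : Set Plane) ↔ ∀ c ∈ t, 0 ≤ bary t c x := by
  rw [← h.range_basis, h.basis.convexHull_eq_nonneg_coord]
  refine ⟨fun H c hc => ?_, fun H c => ?_⟩
  · rw [h.bary_eq hc]; exact H _
  · have := H c c.2
    rwa [h.bary_eq c.2] at this

lemma IsTriangle.mem_interior_iff (h : IsTriangle t) :
    x ∈ interior (convexHull ℝ (t : Set Plane)) ↔ ∀ c ∈ t, 0 < bary t c x := by
  rw [← h.range_basis, h.basis.interior_convexHull]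
  refine ⟨fun H c hc => ?_, fun H c => ?_⟩
  · rw [h.bary_eq hc]; exact H _
  · have := H c c.2
    rwa [h.bary_eq c.2] at this

lemma IsTriangle.sum_bary (h : IsTriangle t) (x : Plane) : ∑ c ∈ t, bary t c x = 1 := by
  rw [← h.basis.sum_coord_apply_eq_one x, ← Finset.sum_coe_sort]
  exact Finset.sum_congr rfl fun c _ => by rw [h.bary_eq c.2]

lemma IsTriangle.sum_bary_smul (h : IsTriangle t) (x : Plane) : ∑ c ∈ t, bary t c x • c = x := by
  conv_rhs => rw [← h.basis.linear_combination_coord_eq_self x]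
  rw [← Finset.sum_coe_sort]
  exact Finset.sum_congr rfl fun c _ => by rw [h.bary_eq c.2, h.basis_apply]

lemma IsTriangle.affineMap_apply (h : IsTriangle t) (f : Plane →ᵃ[ℝ] ℝ) (x : Plane) :
    f x = ∑ c ∈ t, bary t c x * f c := by
  have hf : ∀ y, f y = f.linear y + f 0 := fun y => by
    simpa using congrFun f.decomp y
  rw [hf x]
  conv_lhs => rw [← h.sum_bary_smul x]
  simp only [map_sum, map_smul, smul_eq_mul]
  calc _ = ∑ c ∈ t, bary t c x * f.linear c + (∑ c ∈ t, bary t c x) * f 0 := by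
        rw [h.sum_bary, one_mul]
    _ = _ := by
        rw [Finset.sum_mul, ← Finset.sum_add_distrib]
        exact Finset.sum_congr rfl fun c _ => by rw [hf c]; ring

lemma continuous_bary (t : Finset Plane) (c : Plane) : Continuous (bary t c) :=
  (bary t c).continuous_of_finiteDimensional

lemma IsTriangle.isCompact_convexHull (t : Finset Plane) :
    IsCompact (convexHull ℝ (t : Set Plane)) :=
  t.finite_toSet.isCompact_convexHull ℝ

lemma IsTriangle.interior_nonempty (h : IsTriangle t) :
    (interior (convexHull ℝ (t : Set Plane))).Nonempty := by
  rw [interior_convexHull_nonempty_iff_affineSpan_eq_top, ← h.range_basis]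
  exact h.basis.tot

/-- The gradient of a barycentric coordinate. -/
def baryGrad (t : Finset Plane) (c : Plane) : Plane :=
  (InnerProductSpace.toDual ℝ Plane).symm (LinearMap.toContinuousLinearMap (bary t c).linear)

lemma inner_baryGrad (t : Finset Plane) (c v : Plane) :
    ⟪baryGrad t c, v⟫ = (bary t c).linear v := by
  simp [baryGrad]

lemma bary_sub (t : Finset Plane) (c x y : Plane) :
    bary t c x - bary t c y = ⟪baryGrad t c, x - y⟫ := by
  rw [inner_baryGrad]
  simpa using ((bary t c).linearMap_vsub x y).symm

lemma IsTriangle.baryGrad_ne_zero (h : IsTriangle t) (hc : c ∈ t) : baryGrad t c ≠ 0 := by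
  intro h0
  obtain ⟨d, hd, hdc⟩ := Finset.exists_mem_ne (by rw [h.card_eq]; norm_num) c
  have := bary_sub t c c d
  rw [h.bary_self hc, h.bary_of_ne hc hd hdc.symm, h0] at this
  simp at this

/-- The exterior unit normal of the triangle `t` on the edge opposite to the vertex `c`. -/
def edgeNormal (t : Finset Plane) (c : Plane) : Plane := -(‖baryGrad t c‖⁻¹ • baryGrad t c)

lemma IsTriangle.norm_edgeNormal (h : IsTriangle t) (hc : c ∈ t) : ‖edgeNormal t c‖ = 1 := by
  rw [edgeNormal, norm_neg, norm_smul, norm_inv, norm_norm,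
    inv_mul_cancel₀ (norm_ne_zero_iff.2 (h.baryGrad_ne_zero hc))]

/-- The closed edge of the triangle `t` opposite to the vertex `c`. -/
def edge (t : Finset Plane) (c : Plane) : Set Plane :=
  {x | x ∈ convexHull ℝ (t : Set Plane) ∧ bary t c x = 0}

lemma isCompact_edge (t : Finset Plane) (c : Plane) : IsCompact (edge t c) :=
  (IsTriangle.isCompact_convexHull t).inter_right
    (isClosed_eq (continuous_bary t c) continuous_const)

/-! ### Arc length on segments -/

/-- The arc length parametrisation `ι` is an isometry of `ℝ` into the plane, so it carries
one-dimensional Hausdorff measure on `ℝ`, which is Lebesgue measure, to arc length. -/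
lemma setIntegral_segment (a b : Plane) (f : Plane → ℝ) :
    ∫ x in segment ℝ a b, f x ∂(Measure.hausdorffMeasure 1) =
      ‖b - a‖ * ∫ τ in (0 : ℝ)..1, f (AffineMap.lineMap a b τ) := by
  rcases eq_or_ne a b with rfl | hab
  · have : (Measure.hausdorffMeasure 1 : Measure Plane) {a} = 0 := by
      simpa using hausdorffMeasure_segment a a
    simp [segment_same, Measure.restrict_eq_zero.2 this]
  set e := b - a with he
  have hn : ‖e‖ ≠ 0 := norm_ne_zero_iff.2 (sub_ne_zero.2 hab.symm)
  have hpos : 0 < ‖e‖ := lt_of_le_of_ne (norm_nonneg _) hn.symm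
  let ι : ℝ → Plane := fun s => a + (s * ‖e‖⁻¹) • e
  have hι : Isometry ι := by
    apply Isometry.of_dist_eq
    intro s r
    rw [dist_add_left, dist_eq_norm, ← sub_smul, ← sub_mul, norm_smul, norm_mul, norm_inv,
      norm_norm, inv_mul_cancel_right₀ hn, dist_eq_norm]
  have hm := hι.map_hausdorffMeasure (d := 1) (Or.inl zero_le_one)
  have hsub : segment ℝ a b = ι '' Set.Icc 0 ‖e‖ := by
    rw [segment_eq_image']
    ext y
    constructor
    · rintro ⟨τ, hτ, rfl⟩
      refine ⟨τ * ‖e‖, ⟨by have := hτ.1; positivity, by nlinarith [hτ.2]⟩, ?_⟩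
      change a + (τ * ‖e‖ * ‖e‖⁻¹) • e = a + τ • e
      rw [mul_inv_cancel_right₀ hn]
    · rintro ⟨s, hs, rfl⟩
      refine ⟨s * ‖e‖⁻¹, ⟨by have := hs.1; positivity, ?_⟩, rfl⟩
      rw [← div_eq_mul_inv, div_le_one hpos]; exact hs.2
  have hemb : MeasurableEmbedding ι := hι.isClosedEmbedding.measurableEmbedding
  have h1 : (Measure.hausdorffMeasure 1 : Measure Plane).restrict (segment ℝ a b) =
      (Measure.map ι volume).restrict (segment ℝ a b) := by
    rw [← hausdorffMeasure_real, hm, Measure.restrict_restrict_of_subset]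
    rw [hsub]; exact Set.image_subset_range _ _
  rw [h1, hemb.setIntegral_map, hsub, Set.preimage_image_eq _ hι.injective,
    integral_Icc_eq_integral_Ioc, ← intervalIntegral.integral_of_le hpos.le]
  have h2 := intervalIntegral.integral_comp_div (a := 0) (b := ‖e‖)
    (fun τ => f (AffineMap.lineMap a b τ)) hn
  simp only [zero_div, div_self hn, smul_eq_mul] at h2
  rw [← h2]
  refine intervalIntegral.integral_congr fun s _ => ?_
  simp only [ι, AffineMap.lineMap_apply, vsub_eq_sub, vadd_eq_add, ← he, div_eq_mul_inv]
  rw [add_comm]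

end

noncomputable section

/-! ### Green's formula on a triangle -/

/-- The reference triangle in `ℝ × ℝ`. -/
def refTriangle : Set (ℝ × ℝ) := {p | 0 ≤ p.1 ∧ 0 ≤ p.2 ∧ p.1 + p.2 ≤ 1}

lemma isCompact_refTriangle : IsCompact refTriangle := by
  refine (isCompact_Icc (a := ((0 : ℝ), (0 : ℝ))) (b := (1, 1))).of_isClosed_subset ?_ ?_
  · exact (isClosed_le continuous_const continuous_fst).inter
      ((isClosed_le continuous_const continuous_snd).inter
        (isClosed_le (continuous_fst.add continuous_snd) continuous_const))
  · rintro ⟨s, r⟩ ⟨h1, h2, h3⟩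
    simp only at h1 h2 h3
    exact ⟨⟨h1, h2⟩, ⟨by simp only; linarith, by simp only; linarith⟩⟩

lemma setIntegral_refTriangle {h : ℝ × ℝ → ℝ} (hh : Continuous h) :
    ∫ p in refTriangle, h p = ∫ s in (0 : ℝ)..1, ∫ r in (0 : ℝ)..(1 - s), h (s, r) := by
  have hm := isCompact_refTriangle.measurableSet
  have hi : Integrable (refTriangle.indicator h) (volume.prod volume) :=
    (integrable_indicator_iff hm).2 (hh.continuousOn.integrableOn_compact isCompact_refTriangle)
  rw [← integral_indicator hm]
  change ∫ p, refTriangle.indicator h p ∂(volume.prod volume) = _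
  rw [integral_prod _ hi, intervalIntegral.integral_of_le zero_le_one,
    ← integral_Icc_eq_integral_Ioc, ← integral_indicator measurableSet_Icc]
  congr 1
  ext s
  by_cases hs : s ∈ Set.Icc (0 : ℝ) 1
  · rw [Set.indicator_of_mem hs, intervalIntegral.integral_of_le (by linarith [hs.2]),
      ← integral_Icc_eq_integral_Ioc, ← integral_indicator measurableSet_Icc]
    congr 1
    ext r
    simp only [Set.indicator, refTriangle, Set.mem_ofPred_eq, Set.mem_Icc]
    have : (0 ≤ s ∧ 0 ≤ r ∧ s + r ≤ 1) ↔ (0 ≤ r ∧ r ≤ 1 - s) :=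
      ⟨fun h => ⟨h.2.1, by linarith⟩, fun h => ⟨hs.1, h.1, by linarith⟩⟩
    simp only [this]
  · rw [Set.indicator_of_notMem hs]
    have : ∀ r, refTriangle.indicator h (s, r) = 0 := fun r => by
      refine Set.indicator_of_notMem (fun hm => hs ?_) _
      obtain ⟨h1, h2, h3⟩ := hm
      exact ⟨h1, by simp only at h1 h2 h3; linarith⟩
    simp [this]

lemma setIntegral_refTriangle_swap {h : ℝ × ℝ → ℝ} (hh : Continuous h) :
    ∫ p in refTriangle, h p = ∫ r in (0 : ℝ)..1, ∫ s in (0 : ℝ)..(1 - r), h (s, r) := by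
  have h1 := setIntegral_refTriangle (hh.comp continuous_swap)
  simp only [Function.comp, Prod.swap_prod_mk] at h1
  rw [← h1]
  have h2 := (Measure.measurePreserving_swap (μ := (volume : Measure ℝ))
    (ν := (volume : Measure ℝ))).setIntegral_preimage_emb
    MeasurableEquiv.prodComm.measurableEmbedding h refTriangle
  have h3 : Prod.swap ⁻¹' refTriangle = refTriangle := by
    ext ⟨s, r⟩
    simp only [refTriangle, Set.mem_preimage, Set.mem_ofPred_eq, Prod.swap_prod_mk]
    constructor <;> rintro ⟨h1, h2, h3⟩ <;> exact ⟨h2, h1, by linarith⟩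
  rw [h3] at h2
  exact h2.symm

/-- Fubini in the two possible orders and the fundamental theorem of calculus in the inner variable;
the substitution `s = 1 - r` merges the two integrals over the hypotenuse. -/
lemma green_refTriangle {F G F' G' : ℝ × ℝ → ℝ} (hF : Continuous F) (hG : Continuous G)
    (hF' : Continuous F') (hG' : Continuous G')
    (dF : ∀ s r, HasDerivAt (fun s => F (s, r)) (F' (s, r)) s)
    (dG : ∀ s r, HasDerivAt (fun r => G (s, r)) (G' (s, r)) r) :
    ∫ p in refTriangle, (F' p - G' p) =
      (∫ r in (0 : ℝ)..1, (F (1 - r, r) - G (1 - r, r))) - (∫ r in (0 : ℝ)..1, F (0, r)) +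
        ∫ s in (0 : ℝ)..1, G (s, 0) := by
  have hi : ∀ {h : ℝ × ℝ → ℝ}, Continuous h → IntegrableOn h refTriangle := fun hh =>
    hh.continuousOn.integrableOn_compact isCompact_refTriangle
  have ii : ∀ {h : ℝ → ℝ}, Continuous h → IntervalIntegrable h volume 0 1 := fun hh =>
    hh.intervalIntegrable _ _
  rw [integral_sub (hi hF') (hi hG'), setIntegral_refTriangle_swap hF',
    setIntegral_refTriangle hG']
  have e1 : ∀ r, ∫ s in (0 : ℝ)..(1 - r), F' (s, r) = F (1 - r, r) - F (0, r) := fun r =>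
    intervalIntegral.integral_eq_sub_of_hasDerivAt (fun s _ => dF s r)
      (Continuous.intervalIntegrable (by fun_prop) _ _)
  have e2 : ∀ s, ∫ r in (0 : ℝ)..(1 - s), G' (s, r) = G (s, 1 - s) - G (s, 0) := fun s =>
    intervalIntegral.integral_eq_sub_of_hasDerivAt (fun r _ => dG s r)
      (Continuous.intervalIntegrable (by fun_prop) _ _)
  simp only [e1, e2]
  have e3 : ∫ s in (0 : ℝ)..1, G (s, 1 - s) = ∫ r in (0 : ℝ)..1, G (1 - r, r) := by
    have := intervalIntegral.integral_comp_sub_left (a := 0) (b := 1)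
      (fun r => G (1 - r, r)) (1 : ℝ)
    simpa using this
  rw [intervalIntegral.integral_sub (ii (by fun_prop)) (ii (by fun_prop)),
    intervalIntegral.integral_sub (ii (by fun_prop)) (ii (by fun_prop)),
    intervalIntegral.integral_sub (ii (by fun_prop)) (ii (by fun_prop)), e3]
  ring

/-- The determinant of two vectors of the plane. -/
def cross (u v : Plane) : ℝ := u 0 * v 1 - u 1 * v 0

lemma cross_cyclic (a b c : Plane) : cross (b - a) (c - a) = cross (c - b) (a - b) := by
  simp [cross]; ring

/-- The affine parametrisation of the triangle with vertices `a`, `b`, `c`. -/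
def triParam (a b c : Plane) (p : ℝ × ℝ) : Plane := a + (p.1 • (b - a) + p.2 • (c - a))

lemma continuous_triParam (a b c : Plane) : Continuous (triParam a b c) := by
  unfold triParam; fun_prop

section

variable {a b c : Plane}

/-- Both sides have inner product `0` with `b - a` and `cross (b - a) (c - a)` with `c - a`. This
relates the normal of an edge to its direction, including length and orientation. -/
lemma rot_edge_eq (h : IsTriangle {a, b, c}) (hac : a ≠ c) (hbc : b ≠ c) :
    rot (b - a) = cross (b - a) (c - a) • baryGrad {a, b, c} c := by
  have h1 := bary_sub {a, b, c} c b a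
  have h2 := bary_sub {a, b, c} c c a
  rw [h.bary_of_ne (by simp) (by simp) hbc.symm, h.bary_of_ne (by simp) (by simp) hac.symm,
    inner_plane] at h1
  rw [h.bary_self (by simp), h.bary_of_ne (by simp) (by simp) hac.symm, inner_plane] at h2
  simp only [PiLp.sub_apply] at h1 h2
  apply plane_ext
  · simp only [cross, rot_zero_coord, PiLp.smul_apply, PiLp.sub_apply, smul_eq_mul]
    linear_combination (c 1 - a 1) * h1 - (b 1 - a 1) * h2
  · simp only [cross, rot_one_coord, PiLp.smul_apply, PiLp.sub_apply, smul_eq_mul]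
    linear_combination (-(c 0 - a 0)) * h1 + (b 0 - a 0) * h2

lemma cross_ne_zero (h : IsTriangle {a, b, c}) (hab : a ≠ b) (hac : a ≠ c) (hbc : b ≠ c) :
    cross (b - a) (c - a) ≠ 0 := by
  intro h0
  have h1 := norm_rot (b - a)
  rw [rot_edge_eq h hac hbc, h0, zero_smul, norm_zero] at h1
  exact hab (sub_eq_zero.1 (norm_eq_zero.1 h1.symm)).symm

lemma edge_eq_segment (h : IsTriangle {a, b, c}) (hab : a ≠ b) (hac : a ≠ c) (hbc : b ≠ c) :
    edge {a, b, c} c = segment ℝ a b := by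
  have hsum := fun x => h.sum_bary x
  have hsm := fun x => h.sum_bary_smul x
  have e : ∀ (E : Type) [AddCommMonoid E] (f : Plane → E),
      ∑ v ∈ ({a, b, c} : Finset Plane), f v = f a + (f b + f c) := fun E _ f => by
    rw [Finset.sum_insert (by simp [hab, hac]), Finset.sum_insert (by simp [hbc]),
      Finset.sum_singleton]
  ext x
  constructor
  · rintro ⟨hx, hx0⟩
    rw [h.mem_convexHull_iff] at hx
    have h1 := hsum x
    have h2 := hsm x
    rw [e, hx0] at h1 h2
    refine ⟨_, _, hx a (by simp), hx b (by simp), by linarith, ?_⟩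
    simpa using h2
  · rintro ⟨α, β, hα, hβ, hαβ, rfl⟩
    refine ⟨?_, ?_⟩
    · exact convex_convexHull ℝ _ (subset_convexHull ℝ _ (by simp))
        (subset_convexHull ℝ _ (by simp)) hα hβ hαβ
    · have h1 := bary_sub {a, b, c} c (α • a + β • b) a
      have h2 := bary_sub {a, b, c} c b a
      rw [h.bary_of_ne (by simp) (by simp) hbc.symm, h.bary_of_ne (by simp) (by simp) hac.symm]
        at h2
      have h3 : α • a + β • b - a = β • (b - a) := by
        have : α = 1 - β := by linarith
        subst this; module
      rw [h.bary_of_ne (by simp) (by simp) hac.symm, h3, inner_smul_right, ← h2] at h1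
      simpa using h1

/-- The normal component of the rotated gradient is, up to sign, a tangential derivative. The length
of the edge cancels the normalisation of the normal, leaving the line integral of `f dq` times a
sign that depends only on the orientation of `a, b, c`. -/
lemma setIntegral_edge (h : IsTriangle {a, b, c}) (hab : a ≠ b) (hac : a ≠ c) (hbc : b ≠ c)
    (f q : Plane → ℝ) :
    ∫ x in edge {a, b, c} c, f x * ⟪edgeNormal {a, b, c} c, rot (gradient q x)⟫
        ∂(Measure.hausdorffMeasure 1) =
      -(cross (b - a) (c - a) / |cross (b - a) (c - a)|) *
        ∫ τ in (0 : ℝ)..1, f (AffineMap.lineMap a b τ) *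
          fderiv ℝ q (AffineMap.lineMap a b τ) (b - a) := by
  have hD := cross_ne_zero h hab hac hbc
  have hr := rot_edge_eq h hac hbc
  have hg := h.baryGrad_ne_zero (c := c) (by simp)
  set D := cross (b - a) (c - a)
  set g := baryGrad {a, b, c} c with hgdef
  have hn : ‖b - a‖ = |D| * ‖g‖ := by
    rw [← norm_rot, hr, norm_smul, Real.norm_eq_abs]
  have hg' : ‖g‖ ≠ 0 := norm_ne_zero_iff.2 hg
  have hD' : |D| ≠ 0 := abs_ne_zero.2 hD
  have key : ∀ x, ‖b - a‖ * ⟪edgeNormal {a, b, c} c, rot (gradient q x)⟫ =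
      -(D / |D|) * fderiv ℝ q x (b - a) := by
    intro x
    have h1 : b - a = -(D • rot g) := by
      rw [← rot_smul, ← hr, rot_rot, neg_neg]
    have h2 : ⟪edgeNormal {a, b, c} c, rot (gradient q x)⟫ = ‖g‖⁻¹ * fderiv ℝ q x (rot g) := by
      rw [inner_rot_right, edgeNormal, ← hgdef, rot_neg, rot_smul, inner_neg_left, inner_smul_left,
        neg_neg, real_inner_comm, inner_gradient_left]
      simp
    have h3 : fderiv ℝ q x (b - a) = -(D * fderiv ℝ q x (rot g)) := by
      conv_lhs => rw [h1]
      simp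
    rw [h2, h3, hn]
    have : D * D = |D| * |D| := (abs_mul_abs_self D).symm
    field_simp
    linear_combination (-(fderiv ℝ q x) (rot g)) * this
  rw [edge_eq_segment h hab hac hbc, setIntegral_segment, ← intervalIntegral.integral_const_mul,
    ← intervalIntegral.integral_const_mul]
  refine intervalIntegral.integral_congr fun τ _ => ?_
  beta_reduce
  linear_combination f (AffineMap.lineMap a b τ) * key (AffineMap.lineMap a b τ)

lemma convexHull_eq_image_triParam (h : IsTriangle {a, b, c}) (hab : a ≠ b) (hac : a ≠ c)
    (hbc : b ≠ c) :
    convexHull ℝ (({a, b, c} : Finset Plane) : Set Plane) = triParam a b c '' refTriangle := by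
  have e : ∀ (E : Type) [AddCommMonoid E] (f : Plane → E),
      ∑ v ∈ ({a, b, c} : Finset Plane), f v = f a + (f b + f c) := fun E _ f => by
    rw [Finset.sum_insert (by simp [hab, hac]), Finset.sum_insert (by simp [hbc]),
      Finset.sum_singleton]
  ext x
  constructor
  · intro hx
    rw [h.mem_convexHull_iff] at hx
    have h1 := h.sum_bary x
    have h2 := h.sum_bary_smul x
    rw [e] at h1 h2
    refine ⟨(bary {a, b, c} b x, bary {a, b, c} c x),
      ⟨hx b (by simp), hx c (by simp), by linarith [hx a (by simp)]⟩, ?_⟩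
    conv_rhs => rw [← h2]
    have : bary {a, b, c} a x = 1 - bary {a, b, c} b x - bary {a, b, c} c x := by linarith
    rw [this, triParam]
    module
  · rintro ⟨⟨s, r⟩, ⟨hs, hr, hsr⟩, rfl⟩
    simp only at hs hr hsr
    rw [h.mem_convexHull_iff]
    intro v hv
    have hpos : ∀ w ∈ ({a, b, c} : Finset Plane), 0 ≤ bary {a, b, c} v w := fun w hw =>
      h.mem_convexHull_iff.1 (subset_convexHull ℝ _ hw) v hv
    have h1 := bary_sub {a, b, c} v (triParam a b c (s, r)) a
    have h2 : triParam a b c (s, r) - a = s • (b - a) + r • (c - a) := by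
      rw [triParam]; abel
    rw [h2, inner_add_right, inner_smul_right, inner_smul_right, ← bary_sub, ← bary_sub] at h1
    have ha := hpos a (by simp)
    have hb := hpos b (by simp)
    have hc := hpos c (by simp)
    have h3 : bary {a, b, c} v (triParam a b c (s, r)) = (1 - s - r) * bary {a, b, c} v a +
        s * bary {a, b, c} v b + r * bary {a, b, c} v c := by linear_combination h1
    rw [h3]
    have : 0 ≤ 1 - s - r := by linarith
    positivity

/-- Change of variables: the linear part `A` of `triParam` has determinant `cross (b - a) (c - a)`,
and `m` identifies the plane with `ℝ × ℝ` preserving volume. -/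
lemma integral_convexHull_eq (h : IsTriangle {a, b, c}) (hab : a ≠ b) (hac : a ≠ c)
    (hbc : b ≠ c) (f : Plane → ℝ) :
    ∫ x in convexHull ℝ (({a, b, c} : Finset Plane) : Set Plane), f x =
      |cross (b - a) (c - a)| * ∫ p in refTriangle, f (triParam a b c p) := by
  let m : Plane ≃ᵐ ℝ × ℝ := (MeasurableEquiv.toLp 2 (Fin 2 → ℝ)).symm.trans
    MeasurableEquiv.finTwoArrow
  have hm : MeasurePreserving m volume volume :=
    (volume_preserving_finTwoArrow ℝ).comp
      (EuclideanSpace.volume_preserving_symm_measurableEquiv_toLp (Fin 2))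
  let A : Plane →ₗ[ℝ] Plane :=
    { toFun := fun y => y 0 • (b - a) + y 1 • (c - a)
      map_add' := fun y z => by simp only [PiLp.add_apply]; module
      map_smul' := fun r y => by simp only [PiLp.smul_apply, smul_eq_mul, RingHom.id_apply]; module }
  have hA : ∀ y, triParam a b c (m y) = a + A y := fun y => rfl
  have hdet : LinearMap.det A = cross (b - a) (c - a) := by
    rw [← LinearMap.det_toMatrix (EuclideanSpace.basisFun (Fin 2) ℝ).toBasis, Matrix.det_fin_two]
    simp [LinearMap.toMatrix_apply, A, cross]
    ring
  have hD := cross_ne_zero h hab hac hbc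
  have hinj : Function.Injective A :=
    ((LinearMap.isUnit_iff_isUnit_det A).2 (hdet ▸ hD.isUnit) |> (Module.End.isUnit_iff A).1).1
  have himg : convexHull ℝ (({a, b, c} : Finset Plane) : Set Plane) =
      (fun y => a + A y) '' (m ⁻¹' refTriangle) := by
    rw [convexHull_eq_image_triParam h hab hac hbc]
    ext x
    constructor
    · rintro ⟨p, hp, rfl⟩
      exact ⟨m.symm p, by simpa using hp, by simp [← hA]⟩
    · rintro ⟨y, hy, rfl⟩
      exact ⟨m y, hy, hA y⟩
  rw [himg, integral_image_eq_integral_abs_det_fderiv_smul (f := fun y => a + A y) (f' := fun _ =>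
      LinearMap.toContinuousLinearMap A) volume
    (m.measurable isCompact_refTriangle.measurableSet)
    (fun y _ => ((LinearMap.toContinuousLinearMap A).hasFDerivAt.const_add a).hasFDerivWithinAt)
    (fun y _ z _ hyz => hinj (add_left_cancel hyz))]
  have : (LinearMap.toContinuousLinearMap A).det = cross (b - a) (c - a) := hdet
  simp only [this, smul_eq_mul, integral_const_mul, ← hA]
  congr 1
  exact hm.setIntegral_preimage_emb m.measurableEmbedding (fun p => f (triParam a b c p)) _

lemma hasDerivAt_triParam_fst (f : Plane → ℝ) (hf : Differentiable ℝ f) (s r : ℝ) :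
    HasDerivAt (fun s => f (triParam a b c (s, r)))
      (fderiv ℝ f (triParam a b c (s, r)) (b - a)) s := by
  have h1 : HasDerivAt (fun s : ℝ => triParam a b c (s, r)) (b - a) s := by
    have := (((hasDerivAt_id s).smul_const (b - a)).add_const (r • (c - a))).const_add a
    simpa [triParam] using this
  exact (hf _).hasFDerivAt.comp_hasDerivAt s h1

lemma hasDerivAt_triParam_snd (f : Plane → ℝ) (hf : Differentiable ℝ f) (s r : ℝ) :
    HasDerivAt (fun r => f (triParam a b c (s, r)))
      (fderiv ℝ f (triParam a b c (s, r)) (c - a)) r := by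
  have h1 : HasDerivAt (fun r : ℝ => triParam a b c (s, r)) (c - a) r := by
    have := (((hasDerivAt_id r).smul_const (c - a)).const_add (s • (b - a))).const_add a
    simpa [triParam] using this
  exact (hf _).hasFDerivAt.comp_hasDerivAt r h1

/-- Stokes' theorem for the form `f dq`, whose differential is `df ∧ dq`. -/
lemma setIntegral_refTriangle_curl {f q : Plane → ℝ} (hf : ContDiff ℝ ∞ f)
    (hq : ContDiff ℝ ∞ q) :
    ∫ p in refTriangle,
      (fderiv ℝ f (triParam a b c p) (b - a) * fderiv ℝ q (triParam a b c p) (c - a) -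
        fderiv ℝ f (triParam a b c p) (c - a) * fderiv ℝ q (triParam a b c p) (b - a)) =
      (∫ τ in (0 : ℝ)..1, f (AffineMap.lineMap a b τ) *
          fderiv ℝ q (AffineMap.lineMap a b τ) (b - a)) +
      (∫ τ in (0 : ℝ)..1, f (AffineMap.lineMap b c τ) *
          fderiv ℝ q (AffineMap.lineMap b c τ) (c - b)) +
      ∫ τ in (0 : ℝ)..1, f (AffineMap.lineMap c a τ) *
          fderiv ℝ q (AffineMap.lineMap c a τ) (a - c) := by
  have hψ := continuous_triParam a b c
  have hfd : Differentiable ℝ f := hf.differentiable (by simp)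
  have hfc : Continuous (fderiv ℝ f) := hf.continuous_fderiv (by simp)
  have hq' : ContDiff ℝ ∞ (fderiv ℝ q) := hq.fderiv_right (by simp)
  have hqc : Continuous (fderiv ℝ q) := hq'.continuous
  have hqq : Continuous (fderiv ℝ (fderiv ℝ q)) := hq'.continuous_fderiv (by simp)
  have hv : ∀ v, Differentiable ℝ (fun x => fderiv ℝ q x v) := fun v =>
    (hq'.clm_apply contDiff_const).differentiable (by simp)
  have hvd : ∀ v w x, fderiv ℝ (fun x => fderiv ℝ q x v) x w = fderiv ℝ (fderiv ℝ q) x w v := by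
    intro v w x
    have := ((hq'.differentiable (by simp)) x).hasFDerivAt.clm_apply (hasFDerivAt_const v x)
    rw [this.fderiv]
    simp
  have hsymm : ∀ x v w, fderiv ℝ (fderiv ℝ q) x v w = fderiv ℝ (fderiv ℝ q) x w v := fun x v w =>
    (hq.contDiffAt.isSymmSndFDerivAt
      (by simpa using WithTop.coe_le_coe.2 (le_top (a := (2 : ℕ∞))))).eq v w
  have hfψ : Continuous fun p => f (triParam a b c p) := hf.continuous.comp hψ
  have hfdψ : ∀ v, Continuous fun p => fderiv ℝ f (triParam a b c p) v := fun v =>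
    (hfc.comp hψ).clm_apply continuous_const
  have hqdψ : ∀ v, Continuous fun p => fderiv ℝ q (triParam a b c p) v := fun v =>
    (hqc.comp hψ).clm_apply continuous_const
  have hqqψ : ∀ v w, Continuous fun p => fderiv ℝ (fderiv ℝ q) (triParam a b c p) v w :=
    fun v w => ((hqq.comp hψ).clm_apply continuous_const).clm_apply continuous_const
  have H := green_refTriangle
    (F := fun p => f (triParam a b c p) * fderiv ℝ q (triParam a b c p) (c - a))
    (G := fun p => f (triParam a b c p) * fderiv ℝ q (triParam a b c p) (b - a))
    (F' := fun p => fderiv ℝ f (triParam a b c p) (b - a) *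
        fderiv ℝ q (triParam a b c p) (c - a) + f (triParam a b c p) *
        fderiv ℝ (fderiv ℝ q) (triParam a b c p) (b - a) (c - a))
    (G' := fun p => fderiv ℝ f (triParam a b c p) (c - a) *
        fderiv ℝ q (triParam a b c p) (b - a) + f (triParam a b c p) *
        fderiv ℝ (fderiv ℝ q) (triParam a b c p) (c - a) (b - a))
    (hfψ.mul (hqdψ _)) (hfψ.mul (hqdψ _))
    (((hfdψ _).mul (hqdψ _)).add (hfψ.mul (hqqψ _ _)))
    (((hfdψ _).mul (hqdψ _)).add (hfψ.mul (hqqψ _ _)))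
    (fun s r => by
      have := (hasDerivAt_triParam_fst (a := a) (b := b) (c := c) f hfd s r).mul
        (hasDerivAt_triParam_fst (a := a) (b := b) (c := c) _ (hv (c - a)) s r)
      rwa [hvd] at this)
    (fun s r => by
      have := (hasDerivAt_triParam_snd (a := a) (b := b) (c := c) f hfd s r).mul
        (hasDerivAt_triParam_snd (a := a) (b := b) (c := c) _ (hv (b - a)) s r)
      rwa [hvd] at this)
  -- Second derivatives of `q` are symmetric, so the terms containing them drop out of `F' - G'`.
  have e0 : ∀ p, fderiv ℝ f (triParam a b c p) (b - a) * fderiv ℝ q (triParam a b c p) (c - a) -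
        fderiv ℝ f (triParam a b c p) (c - a) * fderiv ℝ q (triParam a b c p) (b - a) =
      fderiv ℝ f (triParam a b c p) (b - a) *
        fderiv ℝ q (triParam a b c p) (c - a) + f (triParam a b c p) *
        fderiv ℝ (fderiv ℝ q) (triParam a b c p) (b - a) (c - a) -
      (fderiv ℝ f (triParam a b c p) (c - a) *
        fderiv ℝ q (triParam a b c p) (b - a) + f (triParam a b c p) *
        fderiv ℝ (fderiv ℝ q) (triParam a b c p) (c - a) (b - a)) := fun p => by
    rw [hsymm _ (b - a) (c - a)]; ring
  simp only [e0]
  rw [H]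
  have p1 : ∀ τ : ℝ, triParam a b c (1 - τ, τ) = AffineMap.lineMap b c τ := fun τ => by
    simp only [triParam, AffineMap.lineMap_apply, vsub_eq_sub, vadd_eq_add]; module
  have p2 : ∀ τ : ℝ, triParam a b c (0, τ) = AffineMap.lineMap c a (1 - τ) := fun τ => by
    simp only [triParam, AffineMap.lineMap_apply, vsub_eq_sub, vadd_eq_add]; module
  have p3 : ∀ τ : ℝ, triParam a b c (τ, 0) = AffineMap.lineMap a b τ := fun τ => by
    simp only [triParam, AffineMap.lineMap_apply, vsub_eq_sub, vadd_eq_add]; module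
  simp only [p1, p2, p3]
  have i1 : ∀ τ : ℝ, f (AffineMap.lineMap b c τ) * fderiv ℝ q (AffineMap.lineMap b c τ) (c - a) -
      f (AffineMap.lineMap b c τ) * fderiv ℝ q (AffineMap.lineMap b c τ) (b - a) =
      f (AffineMap.lineMap b c τ) * fderiv ℝ q (AffineMap.lineMap b c τ) (c - b) := fun τ => by
    rw [← mul_sub, ← map_sub, sub_sub_sub_cancel_right]
  have i2 : ∫ τ in (0 : ℝ)..1, f (AffineMap.lineMap c a (1 - τ)) *
        fderiv ℝ q (AffineMap.lineMap c a (1 - τ)) (c - a) =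
      -∫ τ in (0 : ℝ)..1, f (AffineMap.lineMap c a τ) *
          fderiv ℝ q (AffineMap.lineMap c a τ) (a - c) := by
    have := intervalIntegral.integral_comp_sub_left (a := 0) (b := 1)
      (fun τ => f (AffineMap.lineMap c a τ) *
          fderiv ℝ q (AffineMap.lineMap c a τ) (c - a)) (1 : ℝ)
    simp only [sub_self, sub_zero] at this
    rw [this, ← intervalIntegral.integral_neg]
    refine intervalIntegral.integral_congr fun τ _ => ?_
    beta_reduce
    rw [← mul_neg, ← map_neg, neg_sub]
  simp only [i1]
  rw [i2]
  ring

/-- The integrand is `-D⁻¹ (df ∧ dq)` in the edge vectors, where `D = cross (b - a) (c - a)`; with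
the Jacobian `|D|` this yields the same sign `-D / |D|` as on the edges. The three edges follow from
one by relabelling the vertices cyclically, under which `D` is invariant. -/
lemma green_triangle (h : IsTriangle {a, b, c}) (hab : a ≠ b) (hac : a ≠ c) (hbc : b ≠ c)
    {f q : Plane → ℝ} (hf : ContDiff ℝ ∞ f) (hq : ContDiff ℝ ∞ q) :
    ∫ x in convexHull ℝ (({a, b, c} : Finset Plane) : Set Plane),
        ⟪gradient f x, rot (gradient q x)⟫ =
      ∑ v ∈ ({a, b, c} : Finset Plane), ∫ x in edge {a, b, c} v,
        f x * ⟪edgeNormal {a, b, c} v, rot (gradient q x)⟫ ∂(Measure.hausdorffMeasure 1) := by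
  have hD := cross_ne_zero h hab hac hbc
  have r1 : ({a, b, c} : Finset Plane) = {b, c, a} := by ext; simp; tauto
  have r2 : ({a, b, c} : Finset Plane) = {c, a, b} := by ext; simp; tauto
  rw [Finset.sum_insert (by simp [hab, hac]), Finset.sum_insert (by simp [hbc]),
    Finset.sum_singleton, integral_convexHull_eq h hab hac hbc]
  have h1 := setIntegral_edge h hab hac hbc f q
  have h2 := setIntegral_edge (r1 ▸ h) hbc hab.symm hac.symm f q
  have h3 := setIntegral_edge (r2 ▸ h) hac.symm hbc.symm hab f q
  rw [← r1] at h2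
  rw [← r2] at h3
  rw [← cross_cyclic] at h2
  rw [← cross_cyclic, ← cross_cyclic] at h3
  have hcurl := setIntegral_refTriangle_curl (a := a) (b := b) (c := c) hf hq
  have key : ∀ p, ⟪gradient f (triParam a b c p), rot (gradient q (triParam a b c p))⟫ =
      -(cross (b - a) (c - a))⁻¹ *
      (fderiv ℝ f (triParam a b c p) (b - a) * fderiv ℝ q (triParam a b c p) (c - a) -
        fderiv ℝ f (triParam a b c p) (c - a) * fderiv ℝ q (triParam a b c p) (b - a)) := by
    intro p
    simp only [← inner_gradient_left]
    generalize gradient f (triParam a b c p) = F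
    generalize gradient q (triParam a b c p) = Q
    rw [neg_mul, eq_neg_iff_add_eq_zero]
    refine (mul_right_injective₀ hD) ?_
    simp only [mul_add, mul_inv_cancel_left₀ hD, mul_zero]
    simp only [inner_plane, rot_zero_coord, rot_one_coord, cross, PiLp.sub_apply]
    ring
  simp only [key]
  rw [integral_const_mul, hcurl, h1, h2, h3]
  have habs : |cross (b - a) (c - a)| ≠ 0 := abs_ne_zero.2 hD
  have hsq := abs_mul_abs_self (cross (b - a) (c - a))
  have hs : |cross (b - a) (c - a)| * -(cross (b - a) (c - a))⁻¹ =
      -(cross (b - a) (c - a) / |cross (b - a) (c - a)|) := by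
    field_simp
    linear_combination -hsq
  rw [← mul_assoc, hs]
  ring

end

lemma IsTriangle.green {t : Finset Plane} (h : IsTriangle t) {f q : Plane → ℝ}
    (hf : ContDiff ℝ ∞ f) (hq : ContDiff ℝ ∞ q) :
    ∫ x in convexHull ℝ (t : Set Plane), ⟪gradient f x, rot (gradient q x)⟫ =
      ∑ v ∈ t, ∫ x in edge t v,
        f x * ⟪edgeNormal t v, rot (gradient q x)⟫ ∂(Measure.hausdorffMeasure 1) := by
  obtain ⟨a, b, c, hab, hac, hbc, rfl⟩ := Finset.card_eq_three.1 h.card_eq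
  exact green_triangle h hab hac hbc hf hq

end

noncomputable section

/-! ### Local structure of triangulations -/

variable {Ω S A : Set Plane} {T : Finset (Finset Plane)} {s t : Finset Plane} {c d x : Plane}

lemma IsTriangulation.isTriangle (h : IsTriangulation A T) (ht : t ∈ T) : IsTriangle t :=
  ⟨h.card_eq t ht, h.indep t ht⟩

/-- The way conformity is exploited: a point common to two triangles has zero barycentric coordinate
at each vertex that is not shared. -/
lemma IsTriangle.bary_eq_zero_of_mem_convexHull_inter (h : IsTriangle t) (hc : c ∈ t)
    (hcs : c ∉ s) (hx : x ∈ convexHull ℝ ((s : Set Plane) ∩ (t : Set Plane))) :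
    bary t c x = 0 := by
  have hconv : Convex ℝ {y | bary t c y = 0} :=
    (convex_singleton (𝕜 := ℝ) (0 : ℝ)).affine_preimage (bary t c)
  refine convexHull_min (s := (s : Set Plane) ∩ (t : Set Plane)) (fun d hd => ?_) hconv hx
  exact h.bary_of_ne hc hd.2 (fun hcd => hcs (hcd ▸ hd.1))

lemma IsTriangulation.exists_mem_notMem (h : IsTriangulation A T) (hs : s ∈ T) (ht : t ∈ T)
    (hst : s ≠ t) : ∃ c ∈ t, c ∉ s := by
  by_contra! H
  exact hst (Finset.eq_of_subset_of_card_le H (by rw [h.card_eq s hs, h.card_eq t ht])).symm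

lemma IsTriangulation.notMem_of_mem_interior (h : IsTriangulation A T) (hs : s ∈ T) (ht : t ∈ T)
    (hst : s ≠ t) (hx : x ∈ interior (convexHull ℝ (t : Set Plane))) :
    x ∉ convexHull ℝ (s : Set Plane) := by
  intro hxs
  obtain ⟨c, hc, hcs⟩ := h.exists_mem_notMem hs ht hst
  have h1 := (h.isTriangle ht).mem_interior_iff.1 hx c hc
  have h2 : x ∈ convexHull ℝ ((s : Set Plane) ∩ (t : Set Plane)) := by
    rw [← h.conforming s hs t ht]
    exact ⟨hxs, interior_subset hx⟩
  rw [(h.isTriangle ht).bary_eq_zero_of_mem_convexHull_inter hc hcs h2] at h1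
  exact lt_irrefl _ h1

/-- If a second coordinate vanished, only one vertex would carry weight, and `x` would be that
vertex. -/
lemma IsTriangle.bary_pos_of_mem_edge (h : IsTriangle t) (hc : c ∈ t) (hx : x ∈ edge t c)
    (hxt : x ∉ t) {a : Plane} (ha : a ∈ t) (hac : a ≠ c) : 0 < bary t a x := by
  refine lt_of_le_of_ne (h.mem_convexHull_iff.1 hx.1 a ha) (fun h0 => hxt ?_)
  have hcard : ((t.erase a).erase c).card = 1 := by
    rw [Finset.card_erase_of_mem (Finset.mem_erase.2 ⟨hac.symm, hc⟩), Finset.card_erase_of_mem ha,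
      h.card_eq]
  obtain ⟨b, hb⟩ := Finset.card_eq_one.1 hcard
  have hbt : b ∈ t := by
    have : b ∈ (t.erase a).erase c := by rw [hb]; simp
    exact Finset.mem_of_mem_erase (Finset.mem_of_mem_erase this)
  have hz : ∀ v ∈ t, v ≠ b → bary t v x = 0 := by
    intro v hv hvb
    by_cases hva : v = a
    · rw [hva, ← h0]
    by_cases hvc : v = c
    · rw [hvc, hx.2]
    have : v ∈ (t.erase a).erase c := by simp [hva, hvc, hv]
    rw [hb] at this
    exact absurd (by simpa using this) hvb
  have h1 := h.sum_bary x
  have h2 := h.sum_bary_smul x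
  rw [Finset.sum_eq_single b hz (fun hb => absurd hbt hb)] at h1
  rw [Finset.sum_eq_single b (fun v hv hvb => by rw [hz v hv hvb, zero_smul])
    (fun hb => absurd hbt hb), h1, one_smul] at h2
  exact h2 ▸ hbt

/-- Near a point in the relative interior of an edge, the other two coordinates stay positive by
continuity, and the triangle looks like a half plane. -/
lemma IsTriangle.eventually_mem_iff (h : IsTriangle t) (hc : c ∈ t) (hx : x ∈ edge t c)
    (hxt : x ∉ t) :
    ∀ᶠ y in 𝓝 x, (y ∈ convexHull ℝ (t : Set Plane) ↔ 0 ≤ bary t c y) ∧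
      (y ∈ interior (convexHull ℝ (t : Set Plane)) ↔ 0 < bary t c y) := by
  have h1 : ∀ᶠ y in 𝓝 x, ∀ a ∈ t.erase c, 0 < bary t a y := by
    rw [Filter.eventually_all_finset]
    intro a ha
    exact (continuous_bary t a).continuousAt.eventually_const_lt
      (h.bary_pos_of_mem_edge hc hx hxt (Finset.mem_of_mem_erase ha) (Finset.ne_of_mem_erase ha))
  filter_upwards [h1] with y hy
  rw [h.mem_convexHull_iff, h.mem_interior_iff]
  refine ⟨⟨fun H => H c hc, fun H a ha => ?_⟩, ⟨fun H => H c hc, fun H a ha => ?_⟩⟩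
  all_goals
    by_cases hac : a = c
    · rwa [hac]
  · exact (hy a (Finset.mem_erase.2 ⟨hac, ha⟩)).le
  · exact hy a (Finset.mem_erase.2 ⟨hac, ha⟩)

lemma IsTriangle.frequently_bary_pos (h : IsTriangle t) (hc : c ∈ t) (hx : 0 ≤ bary t c x) :
    ∃ᶠ y in 𝓝 x, 0 < bary t c y := by
  have hg := h.baryGrad_ne_zero hc
  have h1 : Tendsto (fun τ : ℝ => x + τ • baryGrad t c) (𝓝[>] 0) (𝓝 x) := by
    have : Continuous (fun τ : ℝ => x + τ • baryGrad t c) := by fun_prop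
    have h2 := this.tendsto 0
    simp only [zero_smul, add_zero] at h2
    exact h2.mono_left nhdsWithin_le_nhds
  refine h1.frequently (Eventually.frequently ?_)
  filter_upwards [self_mem_nhdsWithin] with τ hτ
  have h2 := bary_sub t c (x + τ • baryGrad t c) x
  rw [add_sub_cancel_left, inner_smul_right, real_inner_self_eq_norm_sq] at h2
  have h3 : 0 < τ * ‖baryGrad t c‖ ^ 2 := mul_pos hτ (by positivity)
  linarith

lemma IsTriangle.frequently_bary_neg (h : IsTriangle t) (hc : c ∈ t) (hx : bary t c x ≤ 0) :
    ∃ᶠ y in 𝓝 x, bary t c y < 0 := by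
  have hg := h.baryGrad_ne_zero hc
  have h1 : Tendsto (fun τ : ℝ => x - τ • baryGrad t c) (𝓝[>] 0) (𝓝 x) := by
    have : Continuous (fun τ : ℝ => x - τ • baryGrad t c) := by fun_prop
    have h2 := this.tendsto 0
    simp only [zero_smul, sub_zero] at h2
    exact h2.mono_left nhdsWithin_le_nhds
  refine h1.frequently (Eventually.frequently ?_)
  filter_upwards [self_mem_nhdsWithin] with τ hτ
  have h2 := bary_sub t c x (x - τ • baryGrad t c)
  rw [sub_sub_cancel, inner_smul_right, real_inner_self_eq_norm_sq] at h2
  have h3 : 0 < τ * ‖baryGrad t c‖ ^ 2 := mul_pos hτ (by positivity)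
  linarith

/-- Two different triangles of a triangulation that share a point which is not a vertex lie on
opposite sides of a common edge. -/
lemma IsTriangulation.opposite_sides (h : IsTriangulation A T) (hs : s ∈ T) (ht : t ∈ T)
    (hst : s ≠ t) (hc : c ∈ t) (hx : x ∈ edge t c) (hxs : x ∈ convexHull ℝ (s : Set Plane))
    (hv : ∀ t ∈ T, x ∉ t) :
    ∃ d ∈ s, x ∈ edge s d ∧ ∃ κ < 0, ∀ y, bary s d y = κ * bary t c y := by
  have hT := h.isTriangle ht
  have hS := h.isTriangle hs
  have hinter : x ∈ convexHull ℝ ((s : Set Plane) ∩ (t : Set Plane)) := by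
    rw [← h.conforming s hs t ht]; exact ⟨hxs, hx.1⟩
  have hmem : ∀ a ∈ t, a ≠ c → a ∈ s := by
    intro a ha hac
    by_contra has
    have h1 := hT.bary_pos_of_mem_edge hc hx (hv t ht) ha hac
    rw [hT.bary_eq_zero_of_mem_convexHull_inter ha has hinter] at h1
    exact lt_irrefl _ h1
  obtain ⟨d, hd, hdt⟩ := h.exists_mem_notMem ht hs hst.symm
  -- Every vertex of `t` other than `c` lies in `s` and differs from `d`, so the affine function
  -- `bary s d` vanishes there and is determined by its value at `c`.
  have hprop : ∀ y, bary s d y = bary s d c * bary t c y := by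
    intro y
    rw [hT.affineMap_apply (bary s d) y, Finset.sum_eq_single c, mul_comm]
    · intro a ha hac
      rw [hS.bary_of_ne hd (hmem a ha hac) (fun hda => hdt (hda ▸ ha)), mul_zero]
    · exact fun hc' => absurd hc hc'
  have hxd : x ∈ edge s d := ⟨hxs, by rw [hprop, hx.2, mul_zero]⟩
  refine ⟨d, hd, hxd, bary s d c, ?_, hprop⟩
  by_contra! hpos
  have hne : bary s d c ≠ 0 := by
    intro h0
    have := hprop d
    rw [h0, zero_mul, hS.bary_self hd] at this
    exact one_ne_zero this
  have hpos' : 0 < bary s d c := lt_of_le_of_ne hpos hne.symm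
  -- With a positive factor both triangles would lie on the same side of the edge, and their
  -- interiors would meet.
  obtain ⟨y, hy, h1, h2⟩ := ((hT.frequently_bary_pos hc hx.2.ge).and_eventually
    ((hT.eventually_mem_iff hc hx (hv t ht)).and
      (hS.eventually_mem_iff hd hxd (hv s hs)))).exists
  exact h.notMem_of_mem_interior hs ht hst (h1.2.2 hy)
    (interior_subset (h2.2.2 (by rw [hprop]; positivity)))

lemma edgeNormal_eq_neg {κ : ℝ} (hκ : κ < 0) (h : ∀ y, bary s d y = κ * bary t c y) :
    edgeNormal s d = -edgeNormal t c := by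
  have hg : baryGrad s d = κ • baryGrad t c := by
    refine ext_inner_right ℝ fun v => ?_
    rw [inner_smul_left]
    have h1 := bary_sub s d v 0
    have h2 := bary_sub t c v 0
    rw [sub_zero] at h1 h2
    rw [← h1, ← h2, h, h]
    simp; ring
  rw [edgeNormal, edgeNormal, hg, norm_smul, Real.norm_eq_abs, abs_of_neg hκ, mul_inv, smul_smul,
    neg_inv.symm]
  congr 1
  rw [← neg_smul]
  congr 1
  have := hκ.ne
  rw [mul_right_comm, mul_comm, neg_mul, inv_mul_cancel₀ this]
  ring

/-- The quantity is a derivative along `rot (edgeNormal t c)`, a direction tangent to the level line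
of `bary t c`; agreement on that line near `x` is enough. -/
lemma inner_edgeNormal_rot_gradient_congr {q₁ q₂ : Plane → ℝ} (h₁ : DifferentiableAt ℝ q₁ x)
    (h₂ : DifferentiableAt ℝ q₂ x)
    (h : ∀ᶠ y in 𝓝 x, bary t c y = bary t c x → q₁ y = q₂ y) :
    ⟪edgeNormal t c, rot (gradient q₁ x)⟫ = ⟪edgeNormal t c, rot (gradient q₂ x)⟫ := by
  set v := rot (edgeNormal t c) with hv
  have hgv : ⟪baryGrad t c, v⟫ = 0 := by
    rw [hv, edgeNormal, rot_neg, rot_smul, inner_neg_right, inner_smul_right]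
    have : ⟪baryGrad t c, rot (baryGrad t c)⟫ = 0 := by
      simp [inner_plane]; ring
    rw [this]; simp
  have hl : HasDerivAt (fun τ : ℝ => x + τ • v) v 0 := by
    simpa using ((hasDerivAt_id (0 : ℝ)).smul_const v).const_add x
  have hx0 : x + (0 : ℝ) • v = x := by simp
  have d₁ : HasDerivAt (fun τ : ℝ => q₁ (x + τ • v)) (fderiv ℝ q₁ x v) 0 :=
    HasFDerivAt.comp_hasDerivAt_of_eq 0 h₁.hasFDerivAt hl hx0.symm
  have d₂ : HasDerivAt (fun τ : ℝ => q₂ (x + τ • v)) (fderiv ℝ q₂ x v) 0 :=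
    HasFDerivAt.comp_hasDerivAt_of_eq 0 h₂.hasFDerivAt hl hx0.symm
  have hev : (fun τ : ℝ => q₁ (x + τ • v)) =ᶠ[𝓝 0] fun τ : ℝ => q₂ (x + τ • v) := by
    have ht : Tendsto (fun τ : ℝ => x + τ • v) (𝓝 0) (𝓝 x) := by
      simpa [ContinuousAt] using hl.continuousAt
    filter_upwards [ht.eventually h] with τ hτ
    refine hτ ?_
    have := bary_sub t c (x + τ • v) x
    rw [add_sub_cancel_left, inner_smul_right, hgv, mul_zero] at this
    linarith
  have := d₁.unique (d₂.congr_of_eventuallyEq hev)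
  rw [inner_rot_right, inner_rot_right, ← hv, real_inner_comm, real_inner_comm (gradient q₂ x),
    inner_gradient_left, inner_gradient_left, this]

/-! ### Local structure of Lipschitz domains -/

/-- A Lipschitz domain lies on one side of its boundary: moving up from `x` in the local coordinates
leads strictly above the graph, hence out of the closure. -/
lemma IsLipschitzDomain.mem_closure_compl_closure (h : IsLipschitzDomain Ω)
    (hx : x ∈ frontier Ω) : x ∈ closure (closure Ω)ᶜ := by
  obtain ⟨e, K, f, hf, r, hr, hy⟩ := h.locally_subgraph x hx
  have hxΩ : x ∉ Ω := by
    rw [h.isOpen.frontier_eq] at hx; exact hx.2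
  have hxf : f ((e x) 0) ≤ (e x) 1 := by
    by_contra! H
    exact hxΩ ((hy x (Metric.mem_ball_self hr)).2 H)
  rw [Metric.mem_closure_iff]
  intro ε hε
  set δ := min r ε / 2 with hδ
  have hmin : 0 < min r ε := lt_min hr hε
  have hδ0 : 0 < δ := by positivity
  set z : Plane := e.symm (e x + δ • EuclideanSpace.single 1 1) with hz
  have hez : e z = e x + δ • EuclideanSpace.single 1 1 := by simp [hz]
  have hdist : dist x z = δ := by
    rw [← e.dist_map, hez, dist_eq_norm]
    simp [norm_smul, abs_of_pos hδ0]
  have hcoord : ∀ i, Continuous fun y => (e y) i := fun i =>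
    (EuclideanSpace.proj (𝕜 := ℝ) i).continuous.comp e.continuous
  have hU : IsOpen (Metric.ball x r ∩ {y | f ((e y) 0) < (e y) 1}) := by
    refine Metric.isOpen_ball.inter (isOpen_lt ?_ ?_)
    · exact hf.continuous.comp (hcoord 0)
    · exact hcoord 1
  refine ⟨z, fun hzc => ?_, by rw [hdist]; linarith [min_le_right r ε]⟩
  have hzU : z ∈ Metric.ball x r ∩ {y | f ((e y) 0) < (e y) 1} := by
    refine ⟨?_, ?_⟩
    · rw [Metric.mem_ball, dist_comm, hdist]; linarith [min_le_left r ε]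
    · change f ((e z) 0) < (e z) 1
      rw [hez]; simp; linarith
  obtain ⟨w, hw, hwΩ⟩ := mem_closure_iff.1 hzc _ hU hzU
  exact absurd ((hy w hw.1).1 hwΩ) (not_lt.2 (le_of_lt hw.2))

/-- Used to recover the open set `S` from its triangulated closure. -/
lemma IsLipschitzDomain.interior_closure_eq (h : IsLipschitzDomain Ω) :
    interior (closure Ω) = Ω := by
  refine Set.Subset.antisymm (fun x hx => ?_) (interior_maximal subset_closure h.isOpen)
  by_contra hxΩ
  have hfr : x ∈ frontier Ω := by
    rw [h.isOpen.frontier_eq]; exact ⟨interior_subset hx, hxΩ⟩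
  have := h.mem_closure_compl_closure hfr
  rw [closure_compl] at this
  exact this hx

/-- For two different normals, the direction `m - n` points into `Ω` according to `n` and out of it
according to `m`. Uniqueness identifies the chosen value of `exteriorNormal`. -/
lemma IsExteriorNormalAt.unique {n m : Plane} (hn : IsExteriorNormalAt Ω x n)
    (hm : IsExteriorNormalAt Ω x m) : n = m := by
  by_contra hne
  have hlt : ⟪n, m⟫ < 1 := by
    refine lt_of_le_of_ne ?_ ?_
    · simpa [hn.1, hm.1] using real_inner_le_norm n m
    · intro h1; exact hne ((inner_eq_one_iff_of_norm_eq_one hn.1 hm.1).1 h1)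
  set v := m - n with hv
  have hv0 : 0 < ‖v‖ := norm_pos_iff.2 (sub_ne_zero.2 (Ne.symm hne))
  set k := 1 - ⟪n, m⟫ with hk
  have hk0 : 0 < k := by linarith
  have h1 : ⟪n, v⟫ = -k := by
    rw [hv, inner_sub_right, real_inner_self_eq_norm_sq, hn.1, hk]; ring
  have h2 : ⟪m, v⟫ = k := by
    rw [hv, inner_sub_right, real_inner_self_eq_norm_sq, hm.1, hk, real_inner_comm]; ring
  -- Chosen so that `ε * ‖v‖ = k / 2`, half of the normal component of `v` in absolute value.
  set ε := k / (2 * ‖v‖) with hε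
  have hε0 : 0 < ε := by positivity
  have hεv : ε * ‖v‖ = k / 2 := by rw [hε]; field_simp
  have ht : Tendsto (fun τ : ℝ => x + τ • v) (𝓝[>] 0) (𝓝 x) := by
    have : Continuous (fun τ : ℝ => x + τ • v) := by fun_prop
    have h2 := this.tendsto 0
    simp only [zero_smul, add_zero] at h2
    exact h2.mono_left nhdsWithin_le_nhds
  obtain ⟨τ, ⟨ha, hb⟩, hτ⟩ := ((ht.eventually ((hn.2 ε hε0).and (hm.2 ε hε0))).and
    self_mem_nhdsWithin).exists
  have hτ' : 0 < τ := hτ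
  have hτn : ‖τ • v‖ = τ * ‖v‖ := by rw [norm_smul, Real.norm_eq_abs, abs_of_pos hτ']
  rw [add_sub_cancel_left, inner_smul_right, hτn] at ha hb
  have hp : 0 < τ * k := mul_pos hτ' hk0
  have e1 : ε * (τ * ‖v‖) = τ * k / 2 := by linear_combination τ * hεv
  rw [e1] at ha hb
  exact hb.2 (by rw [h2]; linarith) (subset_closure (ha.1 (by rw [h1]; linarith)))

lemma IsExteriorNormalAt.exteriorNormal_eq {n : Plane} (hn : IsExteriorNormalAt Ω x n) :
    exteriorNormal Ω x = n := by
  have h : ∃ n, IsExteriorNormalAt Ω x n := ⟨n, hn⟩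
  rw [exteriorNormal, dif_pos h]
  exact h.choose_spec.unique hn

lemma isExteriorNormalAt_edgeNormal (h : IsTriangle t) (hc : c ∈ t) (hx : bary t c x = 0)
    (hin : ∀ᶠ y in 𝓝 x, 0 < bary t c y → y ∈ Ω)
    (hout : ∀ᶠ y in 𝓝 x, bary t c y < 0 → y ∉ closure Ω) :
    IsExteriorNormalAt Ω x (edgeNormal t c) := by
  refine ⟨h.norm_edgeNormal hc, fun ε hε => ?_⟩
  have hg : 0 < ‖baryGrad t c‖ := norm_pos_iff.2 (h.baryGrad_ne_zero hc)
  have hn : ∀ y, ⟪edgeNormal t c, y - x⟫ = -(‖baryGrad t c‖⁻¹ * bary t c y) := fun y => by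
    rw [edgeNormal, inner_neg_left, inner_smul_left, ← bary_sub, hx]; simp
  filter_upwards [hin, hout] with y h1 h2
  have hε' : 0 ≤ ε * ‖y - x‖ := by positivity
  rw [hn]
  refine ⟨fun H => h1 ?_, fun H => h2 ?_⟩
  · have : 0 < ‖baryGrad t c‖⁻¹ * bary t c y := by linarith
    exact pos_of_mul_pos_right this (by positivity)
  · by_contra! H'
    have : 0 ≤ ‖baryGrad t c‖⁻¹ * bary t c y := by positivity
    linarith

/-! ### Local structure of boundary layers -/

lemma IsTriangulation.closure_eventuallyEq (h : IsTriangulation (closure S) T) (ht : t ∈ T)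
    (honly : ∀ s ∈ T, s ≠ t → x ∉ convexHull ℝ (s : Set Plane)) :
    ∀ᶠ y in 𝓝 x, (y ∈ closure S ↔ y ∈ convexHull ℝ (t : Set Plane)) := by
  have h1 : ∀ᶠ y in 𝓝 x, ∀ s ∈ T.erase t, y ∉ convexHull ℝ (s : Set Plane) := by
    rw [Filter.eventually_all_finset]
    intro s hs
    exact (IsTriangle.isCompact_convexHull s).isClosed.isOpen_compl.mem_nhds
      (honly s (Finset.mem_of_mem_erase hs) (Finset.ne_of_mem_erase hs))
  filter_upwards [h1] with y hy
  rw [← h.covers]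
  simp only [Set.mem_iUnion]
  refine ⟨fun ⟨s, hs, hys⟩ => ?_, fun hyt => ⟨t, ht, hyt⟩⟩
  by_cases hst : s = t
  · rwa [← hst]
  · exact absurd hys (hy s (Finset.mem_erase.2 ⟨hst, hs⟩))

lemma IsTriangulation.convexHull_subset (h : IsTriangulation A T) (ht : t ∈ T) :
    convexHull ℝ (t : Set Plane) ⊆ A := by
  rw [← h.covers]
  exact Set.subset_biUnion_of_mem (u := fun t : Finset Plane => convexHull ℝ (t : Set Plane)) ht

lemma IsBoundaryLayer.interior_convexHull_subset (h : IsBoundaryLayer Ω S T) (ht : t ∈ T) :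
    interior (convexHull ℝ (t : Set Plane)) ⊆ S := by
  rw [← h.lipschitz.interior_closure_eq]
  exact interior_mono (h.triangulation.convexHull_subset ht)

lemma IsBoundaryLayer.notMem_frontier_of_mem (h : IsBoundaryLayer Ω S T)
    (hx : x ∈ S) : x ∉ frontier S := by
  rw [h.lipschitz.isOpen.frontier_eq]
  exact fun H => H.2 hx

/-- The derivative within a set depends only on its germ. A triangle is convex with nonempty
interior, so this derivative is unique even at its boundary points. -/
lemma femGradient_eq {φ q : Plane → ℝ} (h : IsTriangle t)
    (hS : ∀ᶠ y in 𝓝 x, (y ∈ closure S ↔ y ∈ convexHull ℝ (t : Set Plane)))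
    (hx : x ∈ convexHull ℝ (t : Set Plane)) (hq : DifferentiableAt ℝ q x)
    (hφ : Set.EqOn φ q (convexHull ℝ (t : Set Plane))) :
    femGradient S φ x = gradient q x := by
  rw [femGradient, gradientWithin, gradient]
  congr 1
  have h1 : fderivWithin ℝ φ (closure S) x =
      fderivWithin ℝ φ (convexHull ℝ (t : Set Plane)) x :=
    fderivWithin_congr_set (Filter.eventuallyEq_set.2 hS)
  rw [h1, fderivWithin_congr hφ (hφ hx)]
  exact hq.fderivWithin (uniqueDiffWithinAt_convex (convex_convexHull ℝ _) h.interior_nonempty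
    (subset_closure hx))

lemma IsBoundaryLayer.femGradient_eq_of_mem_interior (h : IsBoundaryLayer Ω S T) (ht : t ∈ T)
    {φ q : Plane → ℝ} (hx : x ∈ interior (convexHull ℝ (t : Set Plane)))
    (hq : DifferentiableAt ℝ q x) (hφ : Set.EqOn φ q (convexHull ℝ (t : Set Plane))) :
    femGradient S φ x = gradient q x := by
  refine femGradient_eq (h.triangulation.isTriangle ht) ?_ (interior_subset hx) hq hφ
  filter_upwards [isOpen_interior.mem_nhds hx] with y hy
  exact ⟨fun _ => interior_subset hy,
    fun hy => h.triangulation.convexHull_subset ht hy⟩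

/-- Near a point of `∂Ω` in the relative interior of a boundary edge, `Ω` is a half plane. -/
lemma IsBoundaryLayer.eventually_notMem_closure (h : IsBoundaryLayer Ω S T)
    (hΩ : IsLipschitzDomain Ω) (ht : IsTriangle t) (hc : c ∈ t) (hx : x ∈ frontier Ω)
    (hcl : ∀ᶠ y in 𝓝 x, (y ∈ closure S ↔ 0 ≤ bary t c y))
    (hin : ∀ᶠ y in 𝓝 x, 0 < bary t c y → y ∈ Ω) :
    ∀ᶠ y in 𝓝 x, bary t c y < 0 → y ∉ closure Ω := by
  obtain ⟨r, hr, hball⟩ := Metric.eventually_nhds_iff_ball.1 (hcl.and hin)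
  set N := Metric.ball x r ∩ {y | bary t c y < 0} with hN
  have hNo : IsOpen N := Metric.isOpen_ball.inter
    (isOpen_lt (continuous_bary t c) continuous_const)
  have hNc : Convex ℝ N := (convex_ball x r).inter
    ((convex_Iio (𝕜 := ℝ) (0 : ℝ)).affine_preimage (bary t c))
  -- The half disc `N` misses `closure S`, which contains `∂Ω`. Being connected, `N` is either
  -- inside `Ω` or disjoint from it.
  have hNf : N ∩ frontier Ω = ∅ := by
    refine Set.eq_empty_of_forall_notMem fun y ⟨hy, hyf⟩ => ?_
    have h1 := (hball y hy.1).1.1 (frontier_subset_closure (h.frontier_subset hyf))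
    exact not_lt.2 h1 hy.2
  have hNΩ : N ∩ Ω = ∅ := by
    by_contra hne
    have hsub : N ⊆ Ω := by
      refine hNc.isPreconnected.subset_left_of_subset_union hΩ.isOpen
        isClosed_closure.isOpen_compl
        (disjoint_compl_right.mono_left subset_closure) (fun y hy => ?_)
        (Set.nonempty_iff_ne_empty.2 hne)
      by_contra hyn
      rw [Set.mem_union, not_or, Set.notMem_compl_iff] at hyn
      refine (Set.eq_empty_iff_forall_notMem.1 hNf) y ⟨hy, ?_⟩
      rw [hΩ.isOpen.frontier_eq]
      exact ⟨hyn.2, hyn.1⟩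
    -- If `N ⊆ Ω`, both sides of the edge belong to `Ω`, so the whole ball lies in `closure Ω`,
    -- although the exterior of `Ω` accumulates at `x`.
    obtain ⟨z, hzb, hz⟩ := mem_closure_iff.1 (hΩ.mem_closure_compl_closure hx) _
      Metric.isOpen_ball (Metric.mem_ball_self hr)
    rcases lt_or_ge (bary t c z) 0 with hneg | hpos
    · exact hz (subset_closure (hsub ⟨hzb, hneg⟩))
    · obtain ⟨w, hw, hwb, hwΩ⟩ := ((ht.frequently_bary_pos hc hpos).and_eventually
        ((Metric.isOpen_ball.eventually_mem hzb).and
          (isClosed_closure.isOpen_compl.eventually_mem hz))).exists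
      exact hwΩ (subset_closure ((hball w hwb).2 hw))
  filter_upwards [Metric.ball_mem_nhds x hr] with y hy hneg hycl
  obtain ⟨w, hwN, hwΩ⟩ := mem_closure_iff.1 hycl N hNo ⟨hy, hneg⟩
  exact (Set.eq_empty_iff_forall_notMem.1 hNΩ) w ⟨hwN, hwΩ⟩

/-- The sum over all triangles of the normal components of the curl of a piecewise smooth
function, each taken on the boundary of its triangle. -/
def edgeFlux (T : Finset (Finset Plane)) (q : Finset Plane → Plane → ℝ) (x : Plane) : ℝ :=
  ∑ t ∈ T, ∑ c ∈ t,
    (edge t c).indicator (fun y => ⟪edgeNormal t c, rot (gradient (q t) y)⟫) x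

lemma IsTriangle.sum_indicator_edge (h : IsTriangle t) (hc : c ∈ t) (hx : x ∈ edge t c)
    (hxt : x ∉ t) (F : Plane → Plane → ℝ) :
    ∑ c ∈ t, (edge t c).indicator (F c) x = F c x := by
  rw [Finset.sum_eq_single c, Set.indicator_of_mem hx]
  · intro d hd hdc
    refine Set.indicator_of_notMem (fun hxd => ?_) _
    have := h.bary_pos_of_mem_edge hc hx hxt hd hdc
    rw [hxd.2] at this
    exact lt_irrefl _ this
  · exact fun hc' => absurd hc hc'

lemma sum_indicator_edge_of_notMem (hx : x ∉ convexHull ℝ (t : Set Plane))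
    (F : Plane → Plane → ℝ) : ∑ c ∈ t, (edge t c).indicator (F c) x = 0 :=
  Finset.sum_eq_zero fun _ _ => Set.indicator_of_notMem (fun hx' => hx hx'.1) _

/-- Away from vertices there are three cases. Off all edges both sides are zero; on an edge shared
by two triangles the contributions cancel; on an edge of a single triangle the flux is the exterior
one on `∂Ω` and zero on `Γᶜ`. -/
lemma IsBoundaryLayer.edgeFlux_eq (h : IsBoundaryLayer Ω S T) (hΩ : IsLipschitzDomain Ω)
    {φ : Plane → ℝ} {q : Finset Plane → Plane → ℝ} (hq : ∀ t ∈ T, Differentiable ℝ (q t))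
    (hφ : ∀ t ∈ T, Set.EqOn φ (q t) (convexHull ℝ (t : Set Plane)))
    (hzero : ∀ y ∈ innerBoundary Ω S, φ y = 0) (hv : ∀ t ∈ T, x ∉ t) :
    edgeFlux T q x =
      (frontier Ω).indicator (fun y => ⟪exteriorNormal Ω y, femCurl S φ y⟫) x := by
  have hT := h.triangulation
  by_cases hedge : ∃ t ∈ T, ∃ c ∈ t, x ∈ edge t c
  swap
  · have h0 : x ∉ frontier Ω := by
      intro hx
      have hxS := h.frontier_subset hx
      have hxc := frontier_subset_closure hxS
      rw [← hT.covers] at hxc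
      simp only [Set.mem_iUnion] at hxc
      obtain ⟨t, ht, hxt⟩ := hxc
      refine h.notMem_frontier_of_mem (h.interior_convexHull_subset ht ?_) hxS
      rw [(hT.isTriangle ht).mem_interior_iff]
      intro c hc
      refine lt_of_le_of_ne ((hT.isTriangle ht).mem_convexHull_iff.1 hxt c hc) fun h0 => ?_
      exact hedge ⟨t, ht, c, hc, hxt, h0.symm⟩
    rw [Set.indicator_of_notMem h0, edgeFlux]
    refine Finset.sum_eq_zero fun t ht => Finset.sum_eq_zero fun c hc => ?_
    exact Set.indicator_of_notMem (fun hx => hedge ⟨t, ht, c, hc, hx⟩) _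
  obtain ⟨t, ht, c, hc, hx⟩ := hedge
  have htri := hT.isTriangle ht
  have hloc := htri.eventually_mem_iff hc hx (hv t ht)
  by_cases hother : ∃ s ∈ T, s ≠ t ∧ x ∈ convexHull ℝ (s : Set Plane)
  · obtain ⟨s, hs, hst, hxs⟩ := hother
    obtain ⟨d, hd, hxd, κ, hκ, hprop⟩ := hT.opposite_sides hs ht hst hc hx hxs hv
    have hloc' := (hT.isTriangle hs).eventually_mem_iff hd hxd (hv s hs)
    have hxS : x ∈ S := by
      rw [← h.lipschitz.interior_closure_eq, mem_interior_iff_mem_nhds]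
      filter_upwards [hloc, hloc'] with y h1 h2
      rcases le_total 0 (bary t c y) with hy | hy
      · exact hT.convexHull_subset ht (h1.1.2 hy)
      · exact hT.convexHull_subset hs (h2.1.2 (by rw [hprop]; nlinarith))
    have h0 : x ∉ frontier Ω := fun hx =>
      h.notMem_frontier_of_mem hxS (h.frontier_subset hx)
    rw [Set.indicator_of_notMem h0, edgeFlux, Finset.sum_eq_add t s hst.symm]
    · rw [htri.sum_indicator_edge hc hx (hv t ht), (hT.isTriangle hs).sum_indicator_edge hd hxd
        (hv s hs), edgeNormal_eq_neg hκ hprop, inner_neg_left, add_neg_eq_zero]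
      refine inner_edgeNormal_rot_gradient_congr (hq t ht x) (hq s hs x) ?_
      filter_upwards [hloc, hloc'] with y h1 h2 hy
      rw [hx.2] at hy
      rw [← hφ t ht (h1.1.2 hy.ge), ← hφ s hs (h2.1.2 (by rw [hprop, hy, mul_zero]))]
    -- A third triangle at `x` would lie opposite both `t` and `s`, which are opposite each other:
    -- the factors satisfy `κ' = κ'' * κ` with all three negative.
    · rintro s' hs' ⟨hs't, hs's⟩
      refine sum_indicator_edge_of_notMem (fun hxs' => ?_) _
      obtain ⟨d', hd', hxd', κ', hκ', hprop'⟩ := hT.opposite_sides hs' ht hs't hc hx hxs' hv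
      obtain ⟨d'', hd'', hxd'', κ'', hκ'', hprop''⟩ :=
        hT.opposite_sides hs' hs hs's hd hxd hxs' hv
      have hdd : d'' = d' := by
        by_contra hne
        have := (hT.isTriangle hs').bary_pos_of_mem_edge hd' hxd' (hv s' hs') hd'' hne
        rw [hxd''.2] at this
        exact lt_irrefl _ this
      have e1 := hprop' c
      have e2 := hprop'' c
      rw [hdd, hprop, e1, htri.bary_self hc] at e2
      nlinarith
    · exact fun ht' => absurd ht ht'
    · exact fun hs' => absurd hs hs'
  · push Not at hother
    have hcl := hT.closure_eventuallyEq ht hother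
    have hcl' : ∀ᶠ y in 𝓝 x, (y ∈ closure S ↔ 0 ≤ bary t c y) := by
      filter_upwards [hcl, hloc] with y h1 h2
      rw [h1, h2.1]
    have hsum : edgeFlux T q x = ⟪edgeNormal t c, rot (gradient (q t) x)⟫ := by
      rw [edgeFlux, Finset.sum_eq_single t, htri.sum_indicator_edge hc hx (hv t ht)]
      · exact fun s hs hst => sum_indicator_edge_of_notMem (hother s hs hst) _
      · exact fun ht' => absurd ht ht'
    rw [hsum]
    by_cases hxΩ : x ∈ frontier Ω
    · rw [Set.indicator_of_mem hxΩ]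
      have hin : ∀ᶠ y in 𝓝 x, 0 < bary t c y → y ∈ Ω := by
        filter_upwards [hloc] with y h1 hy
        exact h.subset (h.interior_convexHull_subset ht (h1.2.2 hy))
      have hout := h.eventually_notMem_closure hΩ htri hc hxΩ hcl' hin
      rw [(isExteriorNormalAt_edgeNormal htri hc hx.2 hin hout).exteriorNormal_eq]
      change _ = ⟪_, rot (femGradient S φ x)⟫
      rw [femGradient_eq htri hcl hx.1 (hq t ht x) (hφ t ht)]
    · rw [Set.indicator_of_notMem hxΩ]
      -- On the rest of `∂S` the function `φ` vanishes along the edge, so `q t` has the tangential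
      -- derivative of the zero function.
      have hz : ⟪edgeNormal t c, rot (gradient (fun _ : Plane => (0 : ℝ)) x)⟫ = 0 := by
        rw [gradient_fun_const]
        simp [inner_plane]
      rw [← hz]
      refine inner_edgeNormal_rot_gradient_congr (hq t ht x) (differentiableAt_const _) ?_
      filter_upwards [hloc, hcl'.eventually_nhds, isClosed_frontier.isOpen_compl.mem_nhds hxΩ]
        with y h1 h2 h3 hy
      rw [hx.2] at hy
      have hyt := h1.1.2 hy.ge
      rw [← hφ t ht hyt]
      refine hzero y ⟨⟨hT.convexHull_subset ht hyt, fun hyi => ?_⟩, h3⟩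
      obtain ⟨z, hz, hzS, hzi⟩ := ((htri.frequently_bary_neg hc hy.le).and_eventually
        (h2.and (isOpen_interior.eventually_mem hyi))).exists
      exact not_lt.2 (hzS.1 (subset_closure (interior_subset hzi))) hz

end

noncomputable section

/-! ### Square integrability -/

section

variable {α E : Type*} [MeasurableSpace α] {μ : Measure α} [NormedAddCommGroup E]
  [InnerProductSpace ℝ E]

lemma memLp_two_restrict_of_isCompact {X : Type*} [TopologicalSpace X] [T2Space X]
    [MeasurableSpace X] [BorelSpace X] {ν : Measure X} {K : Set X} (hK : IsCompact K)
    (hν : ν K ≠ ⊤) {F : Type*} [NormedAddCommGroup F] [SecondCountableTopologyEither X F]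
    {f : X → F} (hf : Continuous f) : MemLp f 2 (ν.restrict K) := by
  have : IsFiniteMeasure (ν.restrict K) := ⟨by simpa using hν.lt_top⟩
  obtain ⟨C, hC⟩ := hK.exists_bound_of_continuousOn hf.continuousOn
  refine MemLp.of_bound hf.aestronglyMeasurable C ?_
  filter_upwards [ae_restrict_mem hK.measurableSet] with x hx using hC x hx

lemma inner_toLp_toLp {f h : α → E} (hf : MemLp f 2 μ) (hh : MemLp h 2 μ) :
    ⟪hf.toLp f, hh.toLp h⟫ = ∫ x, ⟪f x, h x⟫ ∂μ := by
  rw [L2.inner_def]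
  refine integral_congr_ae ?_
  filter_upwards [hf.coeFn_toLp, hh.coeFn_toLp] with x h1 h2
  rw [h1, h2]

lemma integrable_inner_of_memLp_two {f h : α → E} (hf : MemLp f 2 μ) (hh : MemLp h 2 μ) :
    Integrable (fun x => ⟪f x, h x⟫) μ := by
  refine (L2.integrable_inner (𝕜 := ℝ) (hf.toLp f) (hh.toLp h)).congr ?_
  filter_upwards [hf.coeFn_toLp, hh.coeFn_toLp] with x h1 h2
  rw [h1, h2]

lemma norm_integral_inner_le {f h : α → E} (hf : MemLp f 2 μ) (hh : MemLp h 2 μ) :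
    ‖∫ x, ⟪f x, h x⟫ ∂μ‖ ≤ (eLpNorm f 2 μ).toReal * (eLpNorm h 2 μ).toReal := by
  rw [← inner_toLp_toLp hf hh, ← Lp.norm_toLp f hf, ← Lp.norm_toLp h hh]
  exact norm_inner_le_norm _ _

lemma tendsto_integral_inner {f h : α → E} {F : ℕ → α → E} (hf : MemLp f 2 μ)
    (hh : MemLp h 2 μ) (hF : ∀ k, AEStronglyMeasurable (F k) μ)
    (hlim : Tendsto (fun k => eLpNorm (f - F k) 2 μ) atTop (𝓝 0)) :
    Tendsto (fun k => ∫ x, ⟪F k x, h x⟫ ∂μ) atTop (𝓝 (∫ x, ⟪f x, h x⟫ ∂μ)) := by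
  rw [tendsto_iff_norm_sub_tendsto_zero]
  have h1 : Tendsto (fun k => (eLpNorm (f - F k) 2 μ).toReal * (eLpNorm h 2 μ).toReal) atTop
      (𝓝 0) := by
    have := ((ENNReal.tendsto_toReal ENNReal.zero_ne_top).comp hlim).mul_const
      (eLpNorm h 2 μ).toReal
    simpa using this
  refine squeeze_zero' (Eventually.of_forall fun _ => norm_nonneg _) ?_ h1
  -- Square integrability of `F k` is not assumed; it holds once the distance to `f` is finite.
  filter_upwards [hlim.eventually_lt_const ENNReal.zero_lt_top] with k hk
  have hd : MemLp (f - F k) 2 μ := ⟨hf.1.sub (hF k), hk⟩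
  have hFk : MemLp (F k) 2 μ := by
    have := hf.sub hd
    rwa [sub_sub_cancel] at this
  have h2 := norm_integral_inner_le hd hh
  rw [norm_sub_rev, ← integral_sub (integrable_inner_of_memLp_two hf hh)
    (integrable_inner_of_memLp_two hFk hh)]
  simpa only [Pi.sub_apply, inner_sub_left] using h2

end

/-! ### Green's formula for finite element functions -/

variable {Ω S : Set Plane} {T : Finset (Finset Plane)} {t : Finset Plane} {c : Plane}
  {φ : Plane → ℝ} {q : Finset Plane → Plane → ℝ}

/-- `φ` coincides with the smooth function `q t` on each triangle `t` of `T`. -/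
structure IsPiecewise (T : Finset (Finset Plane)) (φ : Plane → ℝ)
    (q : Finset Plane → Plane → ℝ) : Prop where
  contDiff : ∀ t ∈ T, ContDiff ℝ ∞ (q t)
  eqOn : ∀ t ∈ T, Set.EqOn φ (q t) (convexHull ℝ (t : Set Plane))

lemma IsPiecewise.differentiable (h : IsPiecewise T φ q) (ht : t ∈ T) : Differentiable ℝ (q t) :=
  (h.contDiff t ht).differentiable (by simp)

lemma continuous_gradient {f : Plane → ℝ} (hf : ContDiff ℝ ∞ f) : Continuous (gradient f) :=
  (InnerProductSpace.toDual ℝ Plane).symm.continuous.comp (hf.continuous_fderiv (by simp))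

lemma continuous_rot_gradient {f : Plane → ℝ} (hf : ContDiff ℝ ∞ f) :
    Continuous fun x => rot (gradient f x) :=
  continuous_rot.comp (continuous_gradient hf)

/-! ### Edge fluxes and piecewise gradients -/

lemma IsTriangle.hausdorffMeasure_edge_ne_top (h : IsTriangle t) (hc : c ∈ t) :
    (Measure.hausdorffMeasure 1 : Measure Plane) (edge t c) ≠ ⊤ := by
  have hcard : (t.erase c).card = 2 := by
    rw [Finset.card_erase_of_mem hc, h.card_eq]
  obtain ⟨a, b, hab, hE⟩ := Finset.card_eq_two.1 hcard
  have hac : a ≠ c := Finset.ne_of_mem_erase (s := t) (by rw [hE]; simp)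
  have hbc : b ≠ c := Finset.ne_of_mem_erase (s := t) (by rw [hE]; simp)
  have ht : t = {a, b, c} := by
    rw [← Finset.insert_erase hc, hE]
    ext v; simp; tauto
  subst ht
  rw [edge_eq_segment h hab hac hbc, hausdorffMeasure_segment]
  exact edist_ne_top a b

lemma memLp_edgeFlux (hT : ∀ t ∈ T, IsTriangle t) (hq : ∀ t ∈ T, ContDiff ℝ ∞ (q t)) :
    MemLp (edgeFlux T q) 2 (Measure.hausdorffMeasure 1) := by
  refine memLp_finsetSum _ fun t ht => memLp_finsetSum _ fun c hc => ?_
  rw [memLp_indicator_iff_restrict (isCompact_edge t c).measurableSet]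
  refine memLp_two_restrict_of_isCompact (isCompact_edge t c)
    ((hT t ht).hausdorffMeasure_edge_ne_top hc) ?_
  exact continuous_const.inner (continuous_rot_gradient (hq t ht))

lemma integral_mul_edgeFlux (hT : ∀ t ∈ T, IsTriangle t) (hq : ∀ t ∈ T, ContDiff ℝ ∞ (q t))
    {f : Plane → ℝ} (hf : ContDiff ℝ ∞ f) :
    ∫ x, f x * edgeFlux T q x ∂(Measure.hausdorffMeasure 1) =
      ∑ t ∈ T, ∫ x in convexHull ℝ (t : Set Plane), ⟪gradient f x, rot (gradient (q t) x)⟫ := by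
  have h1 : ∀ x, f x * edgeFlux T q x = ∑ t ∈ T, ∑ c ∈ t,
      (edge t c).indicator (fun y => f y * ⟪edgeNormal t c, rot (gradient (q t) y)⟫) x := by
    intro x
    simp only [edgeFlux, Finset.mul_sum]
    refine Finset.sum_congr rfl fun t _ => Finset.sum_congr rfl fun c _ => ?_
    by_cases hx : x ∈ edge t c <;> simp [hx]
  have hi : ∀ t ∈ T, ∀ c ∈ t, Integrable ((edge t c).indicator
      (fun y => f y * ⟪edgeNormal t c, rot (gradient (q t) y)⟫))
      (Measure.hausdorffMeasure 1) := by
    intro t ht c hc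
    rw [integrable_indicator_iff (isCompact_edge t c).measurableSet]
    have : IsFiniteMeasure ((Measure.hausdorffMeasure 1 : Measure Plane).restrict (edge t c)) :=
      ⟨by simpa using ((hT t ht).hausdorffMeasure_edge_ne_top hc).lt_top⟩
    exact (memLp_two_restrict_of_isCompact (isCompact_edge t c)
      ((hT t ht).hausdorffMeasure_edge_ne_top hc) (hf.continuous.mul
        (continuous_const.inner (continuous_rot_gradient (hq t ht))))).integrable (by norm_num)
  simp only [h1]
  rw [integral_finsetSum _ fun t ht => integrable_finsetSum _ (hi t ht)]
  refine Finset.sum_congr rfl fun t ht => ?_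
  rw [integral_finsetSum _ (hi t ht), (hT t ht).green hf (hq t ht)]
  exact Finset.sum_congr rfl fun c _ => integral_indicator (isCompact_edge t c).measurableSet

/-- The gradient of a piecewise smooth function, with value `0` on the edges. -/
def pieceGrad (T : Finset (Finset Plane)) (q : Finset Plane → Plane → ℝ) (x : Plane) : Plane :=
  ∑ t ∈ T, (interior (convexHull ℝ (t : Set Plane))).indicator (gradient (q t)) x

lemma memLp_pieceGrad (hq : ∀ t ∈ T, ContDiff ℝ ∞ (q t)) (μ : Measure Plane)
    [IsFiniteMeasureOnCompacts μ] : MemLp (pieceGrad T q) 2 μ := by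
  refine memLp_finsetSum _ fun t ht => ?_
  rw [memLp_indicator_iff_restrict isOpen_interior.measurableSet]
  exact (memLp_two_restrict_of_isCompact (IsTriangle.isCompact_convexHull t)
    (IsTriangle.isCompact_convexHull t).measure_lt_top.ne
    (continuous_gradient (hq t ht))).mono_measure (Measure.restrict_mono interior_subset le_rfl)

lemma volume_frontier_convexHull (t : Finset Plane) :
    volume (frontier (convexHull ℝ (t : Set Plane))) = 0 :=
  (convex_convexHull ℝ _).addHaar_frontier volume

lemma IsBoundaryLayer.ae_mem_interior (h : IsBoundaryLayer Ω S T) :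
    ∀ᵐ x ∂(volume.restrict S), ∃ t ∈ T, x ∈ interior (convexHull ℝ (t : Set Plane)) := by
  have h1 : ∀ᵐ x ∂(volume : Measure Plane),
      ∀ t ∈ T, x ∉ frontier (convexHull ℝ (t : Set Plane)) := by
    rw [Filter.eventually_all_finset]
    exact fun t _ => measure_eq_zero_iff_ae_notMem.1 (volume_frontier_convexHull t)
  filter_upwards [ae_restrict_of_ae h1, ae_restrict_mem h.lipschitz.isOpen.measurableSet]
    with x hx hxS
  have hxc := subset_closure hxS
  rw [← h.triangulation.covers] at hxc
  simp only [Set.mem_iUnion] at hxc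
  obtain ⟨t, ht, hxt⟩ := hxc
  refine ⟨t, ht, ?_⟩
  by_contra hxi
  exact hx t ht ⟨subset_closure hxt, hxi⟩

lemma IsBoundaryLayer.pieceGrad_eq (h : IsBoundaryLayer Ω S T) (ht : t ∈ T) {x : Plane}
    (hx : x ∈ interior (convexHull ℝ (t : Set Plane))) : pieceGrad T q x = gradient (q t) x := by
  rw [pieceGrad, Finset.sum_eq_single t, Set.indicator_of_mem hx]
  · intro s hs hst
    exact Set.indicator_of_notMem (fun hxs => h.triangulation.notMem_of_mem_interior hs ht hst hx
      (interior_subset hxs)) _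
  · exact fun ht' => absurd ht ht'

lemma IsBoundaryLayer.femGradient_ae_eq (h : IsBoundaryLayer Ω S T) (hφ : IsPiecewise T φ q) :
    femGradient S φ =ᵐ[volume.restrict S] pieceGrad T q := by
  filter_upwards [h.ae_mem_interior] with x ⟨t, ht, hx⟩
  rw [h.pieceGrad_eq ht hx,
    h.femGradient_eq_of_mem_interior ht hx (hφ.differentiable ht x) (hφ.eqOn t ht)]

lemma IsBoundaryLayer.memLp_femGradient (h : IsBoundaryLayer Ω S T) (hφ : IsPiecewise T φ q) :
    MemLp (femGradient S φ) 2 (volume.restrict S) :=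
  (memLp_congr_ae (h.femGradient_ae_eq hφ)).2 (memLp_pieceGrad hφ.contDiff _)

lemma IsBoundaryLayer.memLp_femCurl (h : IsBoundaryLayer Ω S T) (hφ : IsPiecewise T φ q) :
    MemLp (femCurl S φ) 2 (volume.restrict S) :=
  (h.memLp_femGradient hφ).continuousLinearMap_comp rotₗᵢ.toContinuousLinearMap

lemma IsBoundaryLayer.integral_inner_femCurl (h : IsBoundaryLayer Ω S T)
    (hφ : IsPiecewise T φ q) {f : Plane → ℝ} (hf : ContDiff ℝ ∞ f) :
    ∫ x in S, ⟪gradient f x, femCurl S φ x⟫ =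
      ∑ t ∈ T, ∫ x in convexHull ℝ (t : Set Plane), ⟪gradient f x, rot (gradient (q t) x)⟫ := by
  set I : Finset Plane → Set Plane := fun t => interior (convexHull ℝ (t : Set Plane)) with hI
  have hIm : ∀ t, MeasurableSet (I t) := fun t => isOpen_interior.measurableSet
  have h1 : ∀ᵐ x ∂(volume.restrict S), ⟪gradient f x, femCurl S φ x⟫ =
      ∑ t ∈ T, (I t).indicator (fun y => ⟪gradient f y, rot (gradient (q t) y)⟫) x := by
    filter_upwards [h.femGradient_ae_eq hφ] with x hx
    change ⟪gradient f x, rot (femGradient S φ x)⟫ = _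
    rw [hx, pieceGrad]
    change ⟪gradient f x, rotₗᵢ _⟫ = _
    rw [map_sum, inner_sum]
    refine Finset.sum_congr rfl fun t _ => ?_
    by_cases hxt : x ∈ I t
    · rw [Set.indicator_of_mem hxt, Set.indicator_of_mem hxt]; rfl
    · rw [Set.indicator_of_notMem hxt, Set.indicator_of_notMem hxt]; simp
  rw [integral_congr_ae h1, integral_finsetSum]
  · refine Finset.sum_congr rfl fun t ht => ?_
    rw [setIntegral_indicator (hIm t), Set.inter_eq_right.2 (h.interior_convexHull_subset ht)]
    exact setIntegral_congr_set (interior_ae_eq_of_null_frontier (volume_frontier_convexHull t))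
  · intro t ht
    refine Integrable.integrableOn ?_
    rw [integrable_indicator_iff (hIm t)]
    exact ((((continuous_gradient hf).inner
      (continuous_rot_gradient (hφ.contDiff t ht))).continuousOn).integrableOn_compact
        (IsTriangle.isCompact_convexHull t)).mono_set interior_subset

/-- Arc length has no atoms, so the vertices, which `IsBoundaryLayer.edgeFlux_eq` excludes, are
negligible. -/
lemma ae_notMem_vertex (T : Finset (Finset Plane)) :
    ∀ᵐ x ∂(Measure.hausdorffMeasure 1 : Measure Plane), ∀ t ∈ T, x ∉ t := by
  have := Measure.nullSingletonClass_hausdorff Plane one_pos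
  rw [Filter.eventually_all_finset]
  exact fun t _ => t.finite_toSet.countable.ae_notMem _

lemma IsBoundaryLayer.edgeFlux_ae_eq (h : IsBoundaryLayer Ω S T) (hΩ : IsLipschitzDomain Ω)
    (hφ : IsPiecewise T φ q) (hzero : ∀ y ∈ innerBoundary Ω S, φ y = 0) :
    edgeFlux T q =ᵐ[Measure.hausdorffMeasure 1]
      (frontier Ω).indicator (fun y => ⟪exteriorNormal Ω y, femCurl S φ y⟫) := by
  filter_upwards [ae_notMem_vertex T] with x hx
  exact h.edgeFlux_eq hΩ (fun t ht => hφ.differentiable ht) hφ.eqOn hzero hx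

/-- Replaces the exterior normal by the finite sum `edgeFlux`, whose square integrability is clear.
-/
lemma IsBoundaryLayer.boundaryForm_eq (h : IsBoundaryLayer Ω S T) (hΩ : IsLipschitzDomain Ω)
    (hφ : IsPiecewise T φ q) (hzero : ∀ y ∈ innerBoundary Ω S, φ y = 0) (f : Plane → ℝ) :
    boundaryForm Ω S f φ = ∫ x, f x * edgeFlux T q x ∂(boundaryMeasure Ω) := by
  refine integral_congr_ae ?_
  filter_upwards [ae_restrict_of_ae (h.edgeFlux_ae_eq hΩ hφ hzero),
    ae_restrict_mem isClosed_frontier.measurableSet] with x hx hxΩ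
  rw [hx, Set.indicator_of_mem hxΩ]

/-- The triangle formulas sum to an integral over all edges; the flux vanishes almost everywhere off
`∂Ω`. -/
lemma IsBoundaryLayer.green (h : IsBoundaryLayer Ω S T) (hΩ : IsLipschitzDomain Ω)
    (hφ : IsPiecewise T φ q) (hzero : ∀ y ∈ innerBoundary Ω S, φ y = 0) {f : Plane → ℝ}
    (hf : ContDiff ℝ ∞ f) :
    ∫ x, f x * edgeFlux T q x ∂(boundaryMeasure Ω) =
      ∫ x in S, ⟪gradient f x, femCurl S φ x⟫ := by
  rw [h.integral_inner_femCurl hφ hf, ← integral_mul_edgeFlux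
    (fun t ht => h.triangulation.isTriangle ht) hφ.contDiff hf]
  refine setIntegral_eq_integral_of_ae_compl_eq_zero ?_
  filter_upwards [h.edgeFlux_ae_eq hΩ hφ hzero] with x hx hxΩ
  rw [hx, Set.indicator_of_notMem hxΩ, mul_zero]

/-! ### Passage to traces -/

lemma MemH1.isWeakGradient {w : Plane → ℝ} (hw : MemH1 Ω w) :
    IsWeakGradient Ω w (weakGradient Ω w) := by
  have h := hw.2
  rw [weakGradient, dif_pos h]
  exact h.choose_spec

/-- Green's formula for the trace of an `H¹` function and a finite element function. -/
lemma IsBoundaryLayer.green_trace (h : IsBoundaryLayer Ω S T) (hΩ : IsLipschitzDomain Ω)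
    (hφ : IsPiecewise T φ q) (hzero : ∀ y ∈ innerBoundary Ω S, φ y = 0) {w f : Plane → ℝ}
    (hw : HasTrace Ω w f) :
    ∫ x, f x * edgeFlux T q x ∂(boundaryMeasure Ω) =
      ∫ x in S, ⟪weakGradient Ω w x, femCurl S φ x⟫ := by
  obtain ⟨hw1, hf, Φ, hΦ, -, hgrad, htr⟩ := hw
  have hle : (volume.restrict S : Measure Plane) ≤ volume.restrict Ω :=
    Measure.restrict_mono h.subset le_rfl
  have hflux : MemLp (edgeFlux T q) 2 (boundaryMeasure Ω) :=
    (memLp_edgeFlux (fun t ht => h.triangulation.isTriangle ht) hφ.contDiff).mono_measure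
      Measure.restrict_le_self
  -- Boundary values converge in `L²(∂Ω)` and gradients in `L²(S)`; the formula for smooth functions
  -- passes to the limit.
  have h1 := tendsto_integral_inner hf hflux
    (fun k => (hΦ k).continuous.aestronglyMeasurable) htr
  have h2 := tendsto_integral_inner (hw1.isWeakGradient.1.mono_measure hle) (h.memLp_femCurl hφ)
    (fun k => (continuous_gradient (hΦ k)).aestronglyMeasurable)
    (tendsto_of_tendsto_of_tendsto_of_le_of_le tendsto_const_nhds hgrad (fun _ => zero_le)
      fun _ => eLpNorm_mono_measure _ hle)
  have hmul : ∀ a b : ℝ, ⟪a, b⟫ = a * b := fun a b => by simp [mul_comm]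
  simp only [hmul] at h1
  refine tendsto_nhds_unique h1 (h2.congr fun k => ?_)
  exact (h.green hΩ hφ hzero (hΦ k)).symm

lemma IsBoundaryLayer.boundaryForm_sub_eq (h : IsBoundaryLayer Ω S T)
    (hΩ : IsLipschitzDomain Ω) (hφ : IsPiecewise T φ q)
    (hzero : ∀ y ∈ innerBoundary Ω S, φ y = 0) {u v g k : Plane → ℝ} (hu : HasTrace Ω u g)
    (hv : HasTrace Ω v k) :
    boundaryForm Ω S (g - k) φ =
      ∫ x in S, ⟪weakGradient Ω u x - weakGradient Ω v x, femCurl S φ x⟫ := by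
  have hle : (volume.restrict S : Measure Plane) ≤ volume.restrict Ω :=
    Measure.restrict_mono h.subset le_rfl
  have hflux : MemLp (edgeFlux T q) 2 (boundaryMeasure Ω) :=
    (memLp_edgeFlux (fun t ht => h.triangulation.isTriangle ht) hφ.contDiff).mono_measure
      Measure.restrict_le_self
  rw [h.boundaryForm_eq hΩ hφ hzero]
  simp only [Pi.sub_apply, sub_mul, inner_sub_left]
  have hint : ∀ {f : Plane → ℝ}, MemLp f 2 (boundaryMeasure Ω) →
      Integrable (fun x => f x * edgeFlux T q x) (boundaryMeasure Ω) :=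
    fun hf => hf.integrable_mul hflux
  rw [integral_sub (hint hu.2.1) (hint hv.2.1),
    integral_sub (integrable_inner_of_memLp_two (hu.1.isWeakGradient.1.mono_measure hle)
      (h.memLp_femCurl hφ)) (integrable_inner_of_memLp_two
      (hv.1.isWeakGradient.1.mono_measure hle) (h.memLp_femCurl hφ)),
    h.green_trace hΩ hφ hzero hu, h.green_trace hΩ hφ hzero hv]

/-! ### The weak gradient of a difference -/

lemma integrable_smul_of_memLp_two {μ : Measure Plane} {f : Plane → ℝ} {G : Plane → Plane}
    (hf : MemLp f 2 μ) (hG : MemLp G 2 μ) : Integrable (fun x => f x • G x) μ :=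
  memLp_one_iff_integrable.1 (hG.smul hf)

lemma IsTestFunction.memLp {ψ : Plane → ℝ} (hψ : IsTestFunction Ω ψ) :
    MemLp ψ 2 (volume.restrict Ω) :=
  hψ.1.continuous.memLp_of_hasCompactSupport hψ.2.1

lemma IsTestFunction.memLp_gradient {ψ : Plane → ℝ} (hψ : IsTestFunction Ω ψ) :
    MemLp (gradient ψ) 2 (volume.restrict Ω) :=
  (continuous_gradient hψ.1).memLp_of_hasCompactSupport
    ((hψ.2.1.fderiv (𝕜 := ℝ)).comp_left (map_zero (InnerProductSpace.toDual ℝ Plane).symm))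

lemma IsWeakGradient.ae_eq (hΩ : IsOpen Ω) {w : Plane → ℝ} {G H : Plane → Plane}
    (hG : IsWeakGradient Ω w G) (hH : IsWeakGradient Ω w H) : G =ᵐ[volume.restrict Ω] H := by
  have hloc : LocallyIntegrableOn (G - H) Ω :=
    locallyIntegrableOn_of_locallyIntegrable_restrict
      ((hG.1.sub hH.1).locallyIntegrable (by norm_num))
  have h0 := hΩ.ae_eq_zero_of_integral_contDiff_smul_eq_zero hloc fun ψ h1 h2 h3 => by
    have hψ : IsTestFunction Ω ψ := ⟨h1, h2, h3⟩
    rw [← setIntegral_eq_integral_of_forall_compl_eq_zero (s := Ω)]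
    · simp only [Pi.sub_apply, smul_sub]
      rw [integral_sub (integrable_smul_of_memLp_two hψ.memLp hG.1)
        (integrable_smul_of_memLp_two hψ.memLp hH.1), sub_eq_zero, ← neg_inj, ← hG.2 ψ hψ,
        hH.2 ψ hψ]
    · intro x hx
      rw [image_eq_zero_of_notMem_tsupport (fun hx' => hx (h3 hx')), zero_smul]
  filter_upwards [ae_restrict_of_ae h0, ae_restrict_mem hΩ.measurableSet] with x h1 h2
  exact sub_eq_zero.1 (h1 h2)

/-- `weakGradient` is a choice, hence linear only up to null sets, by uniqueness of weak gradients.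
-/
lemma weakGradient_sub_ae_eq (hΩ : IsOpen Ω) {u v : Plane → ℝ} (hu : MemH1 Ω u)
    (hv : MemH1 Ω v) :
    weakGradient Ω (u - v) =ᵐ[volume.restrict Ω] weakGradient Ω u - weakGradient Ω v := by
  have h : IsWeakGradient Ω (u - v) (weakGradient Ω u - weakGradient Ω v) := by
    refine ⟨hu.isWeakGradient.1.sub hv.isWeakGradient.1, fun ψ hψ => ?_⟩
    simp only [Pi.sub_apply, sub_smul, smul_sub]
    rw [integral_sub (integrable_smul_of_memLp_two hu.1 hψ.memLp_gradient)
      (integrable_smul_of_memLp_two hv.1 hψ.memLp_gradient),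
      integral_sub (integrable_smul_of_memLp_two hψ.memLp hu.isWeakGradient.1)
        (integrable_smul_of_memLp_two hψ.memLp hv.isWeakGradient.1),
      hu.isWeakGradient.2 ψ hψ, hv.isWeakGradient.2 ψ hψ]
    abel
  exact (MemH1.isWeakGradient ⟨hu.1.sub hv.1, _, h⟩).ae_eq hΩ h

end

noncomputable section

/-! ### The finite element space -/

variable {Ω S : Set Plane} {T : Finset (Finset Plane)} {p : ℕ} {φ ψ : Plane → ℝ}

lemma contDiff_eval (P : MvPolynomial (Fin 2) ℝ) :
    ContDiff ℝ ∞ fun x : Plane => MvPolynomial.eval (fun i => x i) P := by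
  induction P using MvPolynomial.induction_on with
  | C a => simpa using contDiff_const
  | add P Q hP hQ => simpa using hP.add hQ
  | mul_X P i hP =>
    simpa using hP.mul (EuclideanSpace.proj (𝕜 := ℝ) i).contDiff

lemma MemFEM.exists_isPiecewise (h : MemFEM p Ω S T φ) : ∃ q, IsPiecewise T φ q := by
  choose! P hP using h.polynomial
  exact ⟨fun t x => MvPolynomial.eval (fun i => x i) (P t),
    fun t _ => contDiff_eval (P t), fun t ht => (hP t ht).2⟩

/-- The finite element space as a space of functions on the plane. -/
def femSpace (p : ℕ) (Ω S : Set Plane) (T : Finset (Finset Plane)) :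
    Submodule ℝ (Plane → ℝ) where
  carrier := {φ | MemFEM p Ω S T φ}
  zero_mem' := ⟨continuousOn_const, fun _ _ => ⟨0, by simp, by simp⟩, fun _ _ => rfl,
    fun _ _ => rfl⟩
  add_mem' {φ ψ} hφ hψ := by
    refine ⟨hφ.continuousOn.add hψ.continuousOn, fun t ht => ?_, fun x hx => ?_, fun x hx => ?_⟩
    · obtain ⟨P, hP, hPe⟩ := hφ.polynomial t ht
      obtain ⟨Q, hQ, hQe⟩ := hψ.polynomial t ht
      exact ⟨P + Q, (MvPolynomial.totalDegree_add P Q).trans (max_le hP hQ), fun x hx => by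
        rw [Pi.add_apply, hPe x hx, hQe x hx, map_add]⟩
    · rw [Pi.add_apply, hφ.zero_inner x hx, hψ.zero_inner x hx, add_zero]
    · rw [Pi.add_apply, hφ.zero_outside x hx, hψ.zero_outside x hx, add_zero]
  smul_mem' r φ hφ := by
    refine ⟨hφ.continuousOn.const_smul r, fun t ht => ?_, fun x hx => ?_, fun x hx => ?_⟩
    · obtain ⟨P, hP, hPe⟩ := hφ.polynomial t ht
      exact ⟨r • P, (MvPolynomial.totalDegree_smul_le r P).trans hP, fun x hx => by
        rw [Pi.smul_apply, hPe x hx, MvPolynomial.smul_eval, smul_eq_mul]⟩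
    · rw [Pi.smul_apply, hφ.zero_inner x hx, smul_zero]
    · rw [Pi.smul_apply, hφ.zero_outside x hx, smul_zero]

lemma mem_femSpace : φ ∈ femSpace p Ω S T ↔ MemFEM p Ω S T φ := Iff.rfl

/-- Restriction of polynomials of degree at most `p` to a triangle. -/
def polyRestrict (p : ℕ) (t : Finset Plane) :
    MvPolynomial.restrictTotalDegree (Fin 2) ℝ p →ₗ[ℝ] (convexHull ℝ (t : Set Plane) → ℝ) where
  toFun P x := MvPolynomial.eval (fun i => (x : Plane) i) (P : MvPolynomial (Fin 2) ℝ)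
  map_add' P Q := by ext x; simp
  map_smul' r P := by ext x; simp [MvPolynomial.smul_eval]

/-- A finite element function is determined by its restrictions to the finitely many triangles, each
the restriction of a polynomial of bounded degree; outside `closure S` it is zero by convention. -/
lemma finiteDimensional_femSpace (hT : IsTriangulation (closure S) T) :
    FiniteDimensional ℝ (femSpace p Ω S T) := by
  let L : femSpace p Ω S T →ₗ[ℝ] ((t : T) → (polyRestrict p (t : Finset Plane)).range) :=
    { toFun := fun φ t => ⟨fun x => (φ : Plane → ℝ) x, by
        obtain ⟨P, hP, hPe⟩ := (mem_femSpace.1 φ.2).polynomial t t.2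
        exact ⟨⟨P, (MvPolynomial.mem_restrictTotalDegree _ _ _).2 hP⟩,
          funext fun x => (hPe x x.2).symm⟩⟩
      map_add' := fun φ ψ => rfl
      map_smul' := fun r φ => rfl }
  refine FiniteDimensional.of_injective L fun φ ψ h => ?_
  ext x
  by_cases hx : x ∈ closure S
  · rw [← hT.covers] at hx
    simp only [Set.mem_iUnion] at hx
    obtain ⟨t, ht, hxt⟩ := hx
    exact congrFun (congrArg Subtype.val (congrFun h ⟨t, ht⟩)) ⟨x, hxt⟩
  · rw [(mem_femSpace.1 φ.2).zero_outside x hx, (mem_femSpace.1 ψ.2).zero_outside x hx]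

/-! ### The discrete gradient as a linear map into `L²` -/

lemma IsBoundaryLayer.femGradient_add_ae_eq (h : IsBoundaryLayer Ω S T)
    {q r : Finset Plane → Plane → ℝ} (hφ : IsPiecewise T φ q) (hψ : IsPiecewise T ψ r) :
    femGradient S (φ + ψ) =ᵐ[volume.restrict S] femGradient S φ + femGradient S ψ := by
  filter_upwards [h.ae_mem_interior] with x ⟨t, ht, hx⟩
  have h1 := hφ.differentiable ht x
  have h2 := hψ.differentiable ht x
  rw [Pi.add_apply, h.femGradient_eq_of_mem_interior ht hx h1 (hφ.eqOn t ht),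
    h.femGradient_eq_of_mem_interior ht hx h2 (hψ.eqOn t ht),
    h.femGradient_eq_of_mem_interior ht hx (h1.add h2) (fun y hy => by
      rw [Pi.add_apply, Pi.add_apply, hφ.eqOn t ht hy, hψ.eqOn t ht hy])]
  simp only [gradient]
  rw [fderiv_add h1 h2, map_add]

lemma IsBoundaryLayer.femGradient_smul_ae_eq (h : IsBoundaryLayer Ω S T)
    {q : Finset Plane → Plane → ℝ} (r : ℝ) (hφ : IsPiecewise T φ q) :
    femGradient S (r • φ) =ᵐ[volume.restrict S] r • femGradient S φ := by
  filter_upwards [h.ae_mem_interior] with x ⟨t, ht, hx⟩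
  have h1 := hφ.differentiable ht x
  rw [Pi.smul_apply, h.femGradient_eq_of_mem_interior ht hx h1 (hφ.eqOn t ht),
    h.femGradient_eq_of_mem_interior ht hx (h1.const_smul r) (fun y hy => by
      rw [Pi.smul_apply, Pi.smul_apply, hφ.eqOn t ht hy])]
  simp only [gradient]
  rw [fderiv_const_smul h1, map_smul]

lemma IsBoundaryLayer.memLp_femGradient_of_memFEM (h : IsBoundaryLayer Ω S T)
    (hφ : MemFEM p Ω S T φ) : MemLp (femGradient S φ) 2 (volume.restrict S) :=
  h.memLp_femGradient hφ.exists_isPiecewise.choose_spec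

/-- The gradient on the finite element space with values in `L²(S)`. -/
def gradL2 (h : IsBoundaryLayer Ω S T) (p : ℕ) :
    femSpace p Ω S T →ₗ[ℝ] Lp Plane 2 (volume.restrict S) where
  toFun φ := (h.memLp_femGradient_of_memFEM φ.2).toLp _
  map_add' φ ψ := by
    rw [← MemLp.toLp_add]
    exact MemLp.toLp_congr _ _ (h.femGradient_add_ae_eq
      (MemFEM.exists_isPiecewise φ.2).choose_spec (MemFEM.exists_isPiecewise ψ.2).choose_spec)
  map_smul' r φ := by
    rw [RingHom.id_apply, ← MemLp.toLp_const_smul]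
    exact MemLp.toLp_congr _ _ (h.femGradient_smul_ae_eq r
      (MemFEM.exists_isPiecewise φ.2).choose_spec)

lemma inner_gradL2 (h : IsBoundaryLayer Ω S T) (φ ψ : femSpace p Ω S T) :
    ⟪gradL2 h p φ, gradL2 h p ψ⟫ = ∫ x in S, ⟪femGradient S φ x, femGradient S ψ x⟫ :=
  inner_toLp_toLp (h.memLp_femGradient_of_memFEM φ.2) (h.memLp_femGradient_of_memFEM ψ.2)

/-- A finite element function with vanishing gradient is constant on each triangle. -/
lemma IsBoundaryLayer.eq_of_femGradient_ae_eq_zero (h : IsBoundaryLayer Ω S T)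
    {q : Finset Plane → Plane → ℝ} (hφ : IsPiecewise T φ q)
    (h0 : femGradient S φ =ᵐ[volume.restrict S] 0) {t : Finset Plane} (ht : t ∈ T) :
    ∃ k, ∀ x ∈ convexHull ℝ (t : Set Plane), φ x = k := by
  have htri := h.triangulation.isTriangle ht
  set I := interior (convexHull ℝ (t : Set Plane)) with hI
  have hIo : IsOpen I := isOpen_interior
  have hconv := convex_convexHull ℝ (t : Set Plane)
  have h1 : gradient (q t) =ᵐ[volume.restrict I] 0 := by
    have h2 := ae_restrict_of_ae_restrict_of_subset (h.interior_convexHull_subset ht) h0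
    filter_upwards [h2, ae_restrict_mem hIo.measurableSet] with x hx hxI
    rw [← h.femGradient_eq_of_mem_interior ht hxI (hφ.differentiable ht x) (hφ.eqOn t ht), hx]
  -- A continuous gradient that vanishes almost everywhere on an open set vanishes on all of it.
  have h2 := Measure.eqOn_open_of_ae_eq h1 hIo (continuous_gradient (hφ.contDiff t ht)).continuousOn
    continuousOn_const
  have h3 : Set.EqOn (fderiv ℝ (q t)) 0 I := by
    intro x hx
    rw [← toDual_gradient, h2 hx]
    simp
  obtain ⟨z, hz⟩ := htri.interior_nonempty
  refine ⟨q t z, fun x hx => ?_⟩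
  rw [hφ.eqOn t ht hx]
  have hcl : x ∈ closure I := by
    rw [hI, hconv.closure_interior_eq_closure_of_nonempty_interior ⟨z, hz⟩]
    exact subset_closure hx
  have hclosed : IsClosed {y | q t y = q t z} :=
    isClosed_eq (hφ.contDiff t ht).continuous continuous_const
  exact closure_minimal (fun y hy => hIo.is_const_of_fderiv_eq_zero (𝕜 := ℝ)
    hconv.interior.isPreconnected (hφ.differentiable ht).differentiableOn h3 hy hz) hclosed hcl

/-- A function in the kernel is constant on each triangle, so it takes finitely many values on the
connected set `closure S`. Being continuous, it is constant there, and it vanishes at a point of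
`Γᶜ`. -/
lemma injective_gradL2 (h : IsBoundaryLayer Ω S T) (hne : (innerBoundary Ω S).Nonempty) :
    Function.Injective (gradL2 h p) := by
  rw [injective_iff_map_eq_zero]
  intro φ h0
  have hφ := mem_femSpace.1 φ.2
  obtain ⟨q, hq⟩ := hφ.exists_isPiecewise
  have hae : femGradient S φ =ᵐ[volume.restrict S] 0 :=
    (h.memLp_femGradient_of_memFEM hφ).coeFn_toLp.symm.trans
      ((congrArg (fun f : Lp Plane 2 (volume.restrict S) =>
        (f : Plane → Plane)) h0).eventuallyEq.trans
        (Lp.coeFn_zero _ _ _))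
  choose! k hk using fun t ht => h.eq_of_femGradient_ae_eq_zero hq hae (t := t) ht
  have hmaps : Set.MapsTo (φ : Plane → ℝ) (closure S) (k '' T) := by
    intro x hx
    rw [← h.triangulation.covers] at hx
    simp only [Set.mem_iUnion] at hx
    obtain ⟨t, ht, hxt⟩ := hx
    exact ⟨t, ht, (hk t ht x hxt).symm⟩
  obtain ⟨y, hy⟩ := hne
  ext x
  by_cases hx : x ∈ closure S
  · rw [h.lipschitz.isConnected.closure.isPreconnected.constant_of_mapsTo
      (T.finite_toSet.image k).isDiscrete hφ.continuousOn hmaps hx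
      (frontier_subset_closure hy.1), hφ.zero_inner y hy]
    rfl
  · exact hφ.zero_outside x hx

end

end BoundaryLayer

/-! ### Unique solvability and the lower bound -/

theorem corollary3p3 (Ω S : Set Plane) (T : Finset (Finset Plane))
    (hΩ : IsLipschitzDomain Ω) (hΩb : Bornology.IsBounded Ω)
    (hS : IsBoundaryLayer Ω S T) (p : ℕ) (hp : 1 ≤ p)
    (g u : Plane → ℝ) (hu : SolvesDirichlet Ω g u)
    (v vΓ : Plane → ℝ) (hv : IsHarmonicH1 Ω v) (hvΓ : HasTrace Ω v vΓ) :
    ((innerBoundary Ω S).Nonempty → ∃! w : Plane → ℝ, SolvesDiscrete p Ω S T (g - vΓ) w) ∧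
    ∀ w : Plane → ℝ, SolvesDiscrete p Ω S T (g - vΓ) w →
      2 * boundaryForm Ω S (g - vΓ) w - ∫ x in S, ‖femGradient S w x‖ ^ 2
        ≤ ∫ x in Ω, ‖weakGradient Ω (u - v) x‖ ^ 2 := by
  set G : Plane → Plane := weakGradient Ω u - weakGradient Ω v with hGdef
  have hG : MemLp G 2 (volume.restrict Ω) :=
    hu.2.1.isWeakGradient.1.sub hvΓ.1.isWeakGradient.1
  have hGS : MemLp G 2 (volume.restrict S) :=
    hG.mono_measure (Measure.restrict_mono hS.subset le_rfl)
  have hform : ∀ φ, MemFEM p Ω S T φ →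
      boundaryForm Ω S (g - vΓ) φ = ∫ x in S, ⟪G x, femCurl S φ x⟫ := by
    intro φ hφ
    obtain ⟨q, hq⟩ := hφ.exists_isPiecewise
    exact hS.boundaryForm_sub_eq hΩ hq hφ.zero_inner hu.2 hvΓ
  refine ⟨fun hne => ?_, fun w hw => ?_⟩
  · have hfin : FiniteDimensional ℝ (femSpace p Ω S T) :=
      finiteDimensional_femSpace hS.triangulation
    -- The rotation is skew-adjoint, so `-rot G` represents the right-hand side as a functional of
    -- `∇φ`.
    have hF : MemLp (fun x => -rot (G x)) 2 (volume.restrict S) :=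
      (hGS.continuousLinearMap_comp rotₗᵢ.toContinuousLinearMap).neg
    set F := hF.toLp _
    have hℓ : ∀ φ : femSpace p Ω S T, boundaryForm Ω S (g - vΓ) φ = ⟪F, gradL2 hS p φ⟫ := by
      intro φ
      rw [hform φ φ.2]
      refine Eq.trans ?_ (inner_toLp_toLp hF (hS.memLp_femGradient_of_memFEM φ.2)).symm
      refine integral_congr_ae (Eventually.of_forall fun x => ?_)
      change ⟪G x, rot (femGradient S φ x)⟫ = ⟪-rot (G x), femGradient S φ x⟫
      rw [inner_rot_right, inner_neg_left]
    set K := (gradL2 hS p).range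
    -- The discrete equation says that `F - ∇w` is orthogonal to all discrete gradients, so `∇w`
    -- must be the projection of `F`.
    obtain ⟨w, hw⟩ : K.starProjection F ∈ K := Submodule.starProjection_apply_mem _ _
    have hsolves : ∀ φ : femSpace p Ω S T,
        ⟪gradL2 hS p w, gradL2 hS p φ⟫ = boundaryForm Ω S (g - vΓ) φ := by
      intro φ
      rw [hℓ, hw, eq_comm, ← sub_eq_zero, ← inner_sub_left]
      exact Submodule.starProjection_inner_eq_zero _ _ ⟨φ, rfl⟩
    refine ⟨w, ⟨w.2, fun φ hφ => ?_⟩, fun w' hw' => ?_⟩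
    · rw [← hsolves ⟨φ, hφ⟩, inner_gradL2]
    · let w₁ : femSpace p Ω S T := ⟨w', hw'.1⟩
      suffices w₁ = w from congrArg Subtype.val this
      -- The difference of two solutions, tested with itself, has zero gradient.
      refine injective_gradL2 hS hne (sub_eq_zero.1 ?_)
      rw [← map_sub, ← inner_self_eq_zero (𝕜 := ℝ)]
      conv_lhs => enter [2]; rw [map_sub]
      rw [inner_sub_left, hsolves, inner_gradL2, hw'.2 _ (w₁ - w).2, sub_self]
  · obtain ⟨q, hq⟩ := hw.1.exists_isPiecewise
    have hC := hS.memLp_femCurl hq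
    have hsq : ∀ {H : Plane → Plane} {μ : Measure Plane}, MemLp H 2 μ →
        Integrable (fun x => ‖H x‖ ^ 2) μ := fun hH =>
      MemLp.integrable_norm_pow (p := 2) hH two_ne_zero
    have hR : ∫ x in Ω, ‖weakGradient Ω (u - v) x‖ ^ 2 = ∫ x in Ω, ‖G x‖ ^ 2 := by
      refine integral_congr_ae ?_
      filter_upwards [weakGradient_sub_ae_eq hΩ.isOpen hu.2.1 hvΓ.1] with x hx
      rw [hx]
    rw [hform w hw.1, hR, ← integral_const_mul,
      ← integral_sub ((integrable_inner_of_memLp_two hGS hC).const_mul 2)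
        (hsq (hS.memLp_femGradient hq))]
    -- Pointwise this is `0 ≤ ‖G - curl w‖ ^ 2`, with `‖∇w‖ = ‖curl w‖`.
    calc _ ≤ ∫ x in S, ‖G x‖ ^ 2 := by
          refine integral_mono (((integrable_inner_of_memLp_two hGS hC).const_mul 2).sub
            (hsq (hS.memLp_femGradient hq))) (hsq hGS) fun x => ?_
          have h1 : ‖femGradient S w x‖ = ‖femCurl S w x‖ := (norm_rot _).symm
          have h2 := norm_sub_sq_real (G x) (femCurl S w x)
          have h3 := sq_nonneg ‖G x - femCurl S w x‖
          simp only [h1]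
          linarith
      _ ≤ _ := setIntegral_mono_set (hsq hG) (Eventually.of_forall fun x => by positivity)
          (Eventually.of_forall hS.subset)
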